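/- Let $\pi/2\le a<\pi$. For complex-valued $p,q\in L_2(0,\pi)$ vanishing a.e. on $(0,a)$, put $$Q=\begin{bmatrix} q & p\\ p & -q\end{bmatrix},\qquad B=\begin{bmatrix}0&1\\-1&0\end{bmatrix},$$ and for $j\in\{1,2\}$ let ${\cal B}_{1,j}(Q)$ be the boundary value problem $$By'(x)+Q(x)y(x-a)=\lambda y(x),\quad 0<x<\pi,\qquad y_1(0)=y_j(\pi)=0,$$ for absolutely continuous $y=(y_1,y_2)^T$ on $[0,\pi]$. Its eigenvalues are the zeros of its characteristic function $\Delta_j(\lambda)$, the $j$-th component at $x=\pi$ of the solution with $y(0)=(0,1)^T$, and the multiplicity of an eigenvalue is its order as a zero of the entire function $\Delta_j$. Let $\{n_k\}_{k\in\mathbb Z}$ be a (strictly) increasing sequence of integers. A complex sequence $\{\mu_k\}_{k\in\mathbb Z}$ is called a subspectrum of ${\cal B}_{1,j}(Q)$ (with indices $n_k$) if all the eigenvalues of ${\cal B}_{1,j}(Q)$, counted with multiplicity, can be numbered as $\{\lambda_m\}_{m\in\mathbb Z}$ so that $\{\lambda_m-m-\frac{1-j}2\}_{m\in\mathbb Z}\in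 l_2$ and $\mu_k=\lambda_{n_k}$ for all $k\in\mathbb Z$. (1) Let $j\in\{1,2\}$ and let the system $\{\exp(in_{k,j}x)\}_{k\in\mathbb Z}$, with increasing integers $n_{k,j}$, be a Riesz basis in $L_2(a-\pi,\pi-a)$. Then every complex sequence of the form $$\mu_{k,j}=n_{k,j}+\frac{1-j}2+\varkappa_{k,j},\qquad \{\varkappa_{k,j}\}_{k\in\mathbb Z}\in l_2,$$ is a subspectrum (with indices $n_{k,j}$) of ${\cal B}_{1,j}(Q)$ for some $Q$ as above. (2) If the systems $\{\exp(in_{k,j}x)\}_{k\in\mathbb Z}$ for both $j=1$ and $j=2$ are Riesz bases in $L_2(a-\pi,\pi-a)$, then for any two sequences $\{\mu_{k,1}\}$, $\{\mu_{k,2}\}$ of this form there is a single $Q$ as above such that, for each $j=1,2$, $\{\mu_{k,j}\}_{k\in\mathbb Z}$ is a subspectrum of ${\cal B}_{1,j}(Q)$. -/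

import Mathlib

open MeasureTheory Set

noncomputable section

namespace DelayDirac

/-! Indices `1, 2` of the mathematics are the elements `0, 1` of `Fin 2`. -/

/-- A family in a Hilbert space is a Riesz basis if it is the image of an orthonormal basis (here the
standard one of `ℓ²`) under a bounded linear operator with bounded inverse. -/
def IsRieszBasis {ι H : Type*} [DecidableEq ι] [NormedAddCommGroup H] [InnerProductSpace ℂ H]
    (f : ι → H) : Prop :=
  ∃ T : lp (fun _ : ι => ℂ) 2 ≃L[ℂ] H, ∀ k, T (lp.single 2 k 1) = f k

/-- Lebesgue measure on the interval `(a - π, π - a)`. -/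
abbrev symMeasure (a : ℝ) : Measure ℝ := volume.restrict (Ioo (a - Real.pi) (Real.pi - a))

theorem memLp_exp (a : ℝ) (m : ℤ) :
    MemLp (fun x : ℝ => Complex.exp (Complex.I * m * x)) 2 (symMeasure a) := by
  refine MemLp.of_bound (C := 1) (Continuous.aestronglyMeasurable (by fun_prop)) ?_
  refine Filter.Eventually.of_forall fun x => le_of_eq ?_
  have h : Complex.I * (m : ℂ) * (x : ℂ) = (((m : ℝ) * x : ℝ) : ℂ) * Complex.I := by
    push_cast; ring
  rw [h, Complex.norm_exp_ofReal_mul_I]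

/-- The system `exp (i n_k x)`, `k ∈ ℤ`, in `L₂(a - π, π - a)`. -/
def expSystem (a : ℝ) (n : ℤ → ℤ) (k : ℤ) : Lp ℂ 2 (symMeasure a) :=
  (memLp_exp a (n k)).toLp _

/-- The matrix `B`. -/
def B : Matrix (Fin 2) (Fin 2) ℂ := !![0, 1; -1, 0]

/-- Admissible potentials: entries in `L₂(0, π)`, `Q = 0` on `(0, a)`, and
`q₁₁ = -q₂₂`, `q₁₂ = q₂₁` on `(0, π)` (equalities almost everywhere). -/
structure IsAdmissible (a : ℝ) (Q : ℝ → Matrix (Fin 2) (Fin 2) ℂ) : Prop where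
  memLp : ∀ i k, MemLp (fun x => Q x i k) 2 (volume.restrict (Ioo 0 Real.pi))
  eq_zero : ∀ᵐ x ∂volume.restrict (Ioo 0 a), Q x = 0
  diag : ∀ᵐ x ∂volume.restrict (Ioo 0 Real.pi), Q x 0 0 = -Q x 1 1
  offDiag : ∀ᵐ x ∂volume.restrict (Ioo 0 Real.pi), Q x 0 1 = Q x 1 0

/-- `y` is an (absolutely continuous) solution of `B y'(x) + Q(x) y(x - a) = z y(x)`, `0 < x < π`.
When `Q = 0` almost everywhere on `(0, a)`, the values of `y` outside `[0, π]` play no role. -/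
def IsSolution (a : ℝ) (Q : ℝ → Matrix (Fin 2) (Fin 2) ℂ) (z : ℂ) (y : ℝ → Fin 2 → ℂ) : Prop :=
  AbsolutelyContinuousOnInterval y 0 Real.pi ∧
    ∀ᵐ x ∂volume.restrict (Ioo 0 Real.pi), DifferentiableAt ℝ y x ∧
      B.mulVec (deriv y x) + (Q x).mulVec (y (x - a)) = z • y x

/-- `z` is an eigenvalue of the boundary value problem with `y_ν(0) = y_j(π) = 0`. -/
def IsEigenvalue (a : ℝ) (Q : ℝ → Matrix (Fin 2) (Fin 2) ℂ) (ν j : Fin 2) (z : ℂ) : Prop :=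
  ∃ y, IsSolution a Q z y ∧ (∃ x ∈ Icc 0 Real.pi, y x ≠ 0) ∧ y 0 ν = 0 ∧ y Real.pi j = 0

/-- `Y` is the fundamental matrix-solution at the spectral parameter `z`: its columns are
solutions, and `Y(0)` is the identity matrix. -/
def IsFundamental (a : ℝ) (Q : ℝ → Matrix (Fin 2) (Fin 2) ℂ) (z : ℂ)
    (Y : ℝ → Matrix (Fin 2) (Fin 2) ℂ) : Prop :=
  (∀ c, IsSolution a Q z (fun x i => Y x i c)) ∧ Y 0 = 1

/-- `Δ` is the characteristic function of the problem with `y_ν(0) = y_j(π) = 0`: the entry in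
row `j` and in the column other than `ν` of the fundamental matrix-solution at `x = π`. -/
def IsCharFunction (a : ℝ) (Q : ℝ → Matrix (Fin 2) (Fin 2) ℂ) (ν j : Fin 2) (Δ : ℂ → ℂ) : Prop :=
  Differentiable ℂ Δ ∧ ∀ z, ∃ Y, IsFundamental a Q z Y ∧ Δ z = Y Real.pi j (Fin.rev ν)

/-- The sequence `lam` lists all eigenvalues of the problem with `y_ν(0) = y_j(π) = 0`, each as
many times as its multiplicity, which is its order as a zero of the characteristic function. -/
def IsSpectrum (a : ℝ) (Q : ℝ → Matrix (Fin 2) (Fin 2) ℂ) (ν j : Fin 2) (lam : ℤ → ℂ) : Prop :=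
  (∀ z, IsEigenvalue a Q ν j z ↔ z ∈ range lam) ∧
    ∃ Δ, IsCharFunction a Q ν j Δ ∧ ∀ z, {m : ℤ | lam m = z}.encard = analyticOrderAt Δ z

/-- The asymptotics `μ_k = n_k + (1 - j)/2 + ϰ_k` with `ϰ ∈ ℓ₂`, for `j ∈ {1, 2}`; the element
`j : Fin 2` stands for the index `j + 1`, so that `(1 - j)/2` becomes `-j/2`. -/
def HasAsymptotics (j : Fin 2) (n : ℤ → ℤ) (μ : ℤ → ℂ) : Prop :=
  Memℓp (fun k => μ k - ((n k : ℂ) - (j.val : ℂ) / 2)) 2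

/-- `μ` is the subspectrum with the indices `n_k` of the problem with `y_1(0) = y_j(π) = 0`:
`μ_k = lam (n_k)`, where `lam m = m + (1 - j)/2 + ℓ₂`, `m ∈ ℤ`, is the whole spectrum. -/
def IsSubspectrum (a : ℝ) (Q : ℝ → Matrix (Fin 2) (Fin 2) ℂ) (j : Fin 2) (n : ℤ → ℤ)
    (μ : ℤ → ℂ) : Prop :=
  ∃ lam : ℤ → ℂ, IsSpectrum a Q 0 j lam ∧ HasAsymptotics j id lam ∧ ∀ k, μ k = lam (n k)

end DelayDirac

end

noncomputable section

namespace DelayDirac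

open Filter Topology

/-! ### Absolutely continuous functions -/

/-! In the variables `U = y₁ + i y₂`, `V = y₁ - i y₂` the system reads `U' = i z U + r V(x - a)`,
`V' = -i z V + s U(x - a)`, with `r`, `s` vanishing up to `a`. Since `a ≥ π/2`, the delayed argument
`x - a` never leaves `[0, a]` while `r` or `s` is active, and there the solution is a pure
exponential. One variation of constants therefore solves the system exactly, and the characteristic
functions are `-sin πz` and `cos πz` plus exponential transforms of `L₂` densities `w₁`, `w₂` on `(a
- π, π - a)`. The pair `(w₁, w₂)` depends on `(r, s)` through an invertible linear substitution, so
any two densities are realised by one potential (`exists_potential`). This decouples the two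
problems in the second claim.

Shifting `z` by `1/2` turns the cosine into a sine, so it remains to treat `sin πz + F(z)` with `F`
in the Paley–Wiener class (`exists_density`). Two things are needed.

Interpolation: `F` must make the sum vanish, with multiplicity, at the nodes `n_k + ϰ_k`. If the
`ϰ_k` are small in `ℓ₂`, the perturbed exponentials are still a Riesz basis, and the moments `-sin
π(n_k + ϰ_k)` are square summable because `sin πn_k = 0`; the moment problem is then solvable. In
general this holds after resetting finitely many nodes to integers. These are moved back one at a
time (`IsInterpolating.update`), using that dividing a Paley–Wiener function by `z - ν` at a zero
`ν` stays in the class. Coinciding nodes thus need no separate treatment.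

Numbering: away from the integers `|F| < |sin πz|` for large `|z|`. By Rouché, a large disc of
radius `N + 1/2` holds `2N + 1` zeros, and every integer `m` with `|m| > N` has exactly one simple
zero nearby, at distance at most `|F(m)|`; these bounds are square summable by Parseval
(`exists_zeros_localization`). The far prescribed nodes are forced to be these zeros; the near ones
form a sub-multiset of the zeros in the disc, and the remaining zeros are assigned to the remaining
indices (`exists_numbering`). -/

theorem absolutelyContinuous_ofReal {f : ℝ → ℝ} {c d : ℝ}
    (hf : AbsolutelyContinuousOnInterval f c d) :
    AbsolutelyContinuousOnInterval (fun x => (f x : ℂ)) c d := by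
  unfold AbsolutelyContinuousOnInterval at *
  simpa [Complex.isometry_ofReal.dist_eq] using hf

theorem absolutelyContinuous_primitive {f : ℝ → ℂ} {c d e : ℝ}
    (hf : IntervalIntegrable f volume c d) (he : e ∈ uIcc c d) :
    AbsolutelyContinuousOnInterval (fun x => ∫ t in e..x, f t) c d := by
  have hre : IntervalIntegrable (fun t => (f t).re) volume c d :=
    ⟨hf.1.re, hf.2.re⟩
  have him : IntervalIntegrable (fun t => (f t).im) volume c d :=
    ⟨hf.1.im, hf.2.im⟩
  have h1 := absolutelyContinuous_ofReal
    (hre.absolutelyContinuousOnInterval_intervalIntegral he)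
  have h2 := (absolutelyContinuous_ofReal
    (him.absolutelyContinuousOnInterval_intervalIntegral he)).const_smul Complex.I
  have h3 := h1.add h2
  unfold AbsolutelyContinuousOnInterval at *
  refine h3.congr' ?_
  -- The primitive equals the combination of its real and imaginary primitives only on `[c, d]`, so
  -- the comparison is made inside the sums, whose intervals have endpoints there.
  filter_upwards [mem_inf_of_right (mem_principal_self _)] with E hE
  refine Finset.sum_congr rfl fun i hi => ?_
  have key : ∀ x ∈ uIcc c d, (∫ t in e..x, f t) =
      ((fun x => ((∫ t in e..x, (f t).re : ℝ) : ℂ)) +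
        fun x => Complex.I • ((∫ t in e..x, (f t).im : ℝ) : ℂ)) x := by
    intro x hx
    have hs : uIcc e x ⊆ uIcc c d := uIcc_subset_uIcc he hx
    have hfx := hf.mono_set hs
    have r1 := (hre.mono_set hs)
    have r2 := (him.mono_set hs)
    simp only [Pi.add_apply, smul_eq_mul]
    rw [← intervalIntegral.integral_ofReal, ← intervalIntegral.integral_ofReal,
      ← intervalIntegral.integral_const_mul, ← intervalIntegral.integral_add]
    · refine intervalIntegral.integral_congr fun t _ => ?_
      rw [mul_comm]; exact (Complex.re_add_im _).symm
    · exact ⟨r1.1.ofReal, r1.2.ofReal⟩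
    · exact (IntervalIntegrable.const_mul ⟨r2.1.ofReal, r2.2.ofReal⟩ _)
  have hm := hE.1 i hi
  rw [key _ hm.1, key _ hm.2]

/-- Fundamental theorem of calculus for absolutely continuous complex functions. -/
theorem integral_eq_sub_of_absolutelyContinuous {f f' : ℝ → ℂ} {c d : ℝ}
    (hf : AbsolutelyContinuousOnInterval f c d)
    (hf' : IntervalIntegrable f' volume c d)
    (h : ∀ᵐ x, x ∈ uIcc c d → HasDerivAt f (f' x) x) {x : ℝ} (hx : x ∈ uIcc c d) :
    ∫ t in c..x, f' t = f x - f c := by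
  -- The difference from the primitive of `f'` is absolutely continuous with derivative zero almost
  -- everywhere, hence constant.
  have hac := hf.sub (absolutelyContinuous_primitive hf' left_mem_uIcc)
  obtain ⟨C, hC⟩ := hac.const_of_ae_hasDerivAt_zero (by
    filter_upwards [h, hf'.ae_hasDerivAt_integral] with x h1 h2 hx
    simpa using (h1 hx).sub (h2 hx c left_mem_uIcc))
  have h1 := hC c left_mem_uIcc
  have h2 := hC x hx
  simp only [Pi.sub_apply, intervalIntegral.integral_same, sub_zero] at h1 h2
  rw [h1, ← h2]; ring

theorem absolutelyContinuous_of_contDiff {f : ℝ → ℂ} (hf : ContDiff ℝ 1 f) (c d : ℝ) :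
    AbsolutelyContinuousOnInterval f c d :=
  hf.contDiffOn.absolutelyContinuousOnInterval

theorem contDiff_cexp_mul (z : ℂ) : ContDiff ℝ 1 fun x : ℝ => Complex.exp (z * x) :=
  (contDiff_const.mul Complex.ofRealCLM.contDiff).cexp

theorem hasDerivAt_cexp_mul (z : ℂ) (x : ℝ) :
    HasDerivAt (fun x : ℝ => Complex.exp (z * x)) (z * Complex.exp (z * x)) x := by
  have h := ((hasDerivAt_id (x : ℂ)).const_mul z).cexp.comp_ofReal
  simpa [mul_comm] using h

/-! ### Exponential transforms -/

/-- The transform `z ↦ ∫ f(x) exp (i z x) dx` over `(a - π, π - a)`. -/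
def expTransform (a : ℝ) (f : ℝ → ℂ) (z : ℂ) : ℂ :=
  ∫ x, f x * Complex.exp (Complex.I * z * x) ∂symMeasure a

/-- Transforms of square integrable functions on `(a - π, π - a)`. -/
def IsPaleyWiener (a : ℝ) (F : ℂ → ℂ) : Prop :=
  ∃ f, MemLp f 2 (symMeasure a) ∧ F = expTransform a f

theorem norm_cexp_le {a Y : ℝ} {z : ℂ} {x : ℝ} (hz : |z.im| ≤ Y)
    (hx : x ∈ Ioo (a - Real.pi) (Real.pi - a)) :
    ‖Complex.exp (Complex.I * z * x)‖ ≤ Real.exp (Y * (Real.pi - a)) := by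
  rw [Complex.norm_exp, Real.exp_le_exp]
  have h1 : |x| ≤ Real.pi - a := abs_le.2 ⟨by linarith [hx.1], hx.2.le⟩
  calc (Complex.I * z * x).re = -(z.im * x) := by simp
    _ ≤ |z.im * x| := neg_le_abs _
    _ = |z.im| * |x| := abs_mul _ _
    _ ≤ Y * (Real.pi - a) :=
      mul_le_mul hz h1 (abs_nonneg _) ((abs_nonneg _).trans hz)

theorem ae_norm_cexp_le (a : ℝ) (z : ℂ) : ∀ᵐ x : ℝ ∂symMeasure a,
    ‖Complex.exp (Complex.I * z * x)‖ ≤ Real.exp (|z.im| * (Real.pi - a)) :=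
  ae_restrict_of_forall_mem measurableSet_Ioo fun _ hx => norm_cexp_le le_rfl hx

theorem aestronglyMeasurable_cexp {a : ℝ} (z : ℂ) :
    AEStronglyMeasurable (fun x : ℝ => Complex.exp (Complex.I * z * x)) (symMeasure a) :=
  Continuous.aestronglyMeasurable (by fun_prop)

theorem integrable_mul_cexp {a : ℝ} {f : ℝ → ℂ} (hf : Integrable f (symMeasure a)) (z : ℂ) :
    Integrable (fun x : ℝ => f x * Complex.exp (Complex.I * z * x)) (symMeasure a) :=
  hf.mul_bdd (aestronglyMeasurable_cexp z) (ae_norm_cexp_le a z)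

theorem integrable_of_memLp {a : ℝ} {f : ℝ → ℂ} (hf : MemLp f 2 (symMeasure a)) :
    Integrable f (symMeasure a) :=
  hf.integrable (by norm_num)

theorem norm_expTransform_le {a Y : ℝ} {f : ℝ → ℂ} (hf : Integrable f (symMeasure a)) {z : ℂ}
    (hz : |z.im| ≤ Y) :
    ‖expTransform a f z‖ ≤ (∫ x, ‖f x‖ ∂symMeasure a) * Real.exp (Y * (Real.pi - a)) := by
  rw [← integral_mul_const]
  refine norm_integral_le_of_norm_le (hf.norm.mul_const _) ?_
  refine ae_restrict_of_forall_mem measurableSet_Ioo fun x hx => ?_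
  rw [norm_mul]
  exact mul_le_mul_of_nonneg_left (norm_cexp_le hz hx) (norm_nonneg _)

theorem expTransform_add {a : ℝ} {f g : ℝ → ℂ} (hf : Integrable f (symMeasure a))
    (hg : Integrable g (symMeasure a)) :
    expTransform a (f + g) = expTransform a f + expTransform a g := by
  funext z
  simp only [expTransform, Pi.add_apply, add_mul]
  exact integral_add (integrable_mul_cexp hf z) (integrable_mul_cexp hg z)

theorem expTransform_const_mul (a : ℝ) (c : ℂ) (f : ℝ → ℂ) :
    expTransform a (fun x => c * f x) = fun z => c * expTransform a f z := by
  funext z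
  simp only [expTransform, mul_assoc]
  exact integral_const_mul _ _

theorem IsPaleyWiener.add {a : ℝ} {F G : ℂ → ℂ} (hF : IsPaleyWiener a F)
    (hG : IsPaleyWiener a G) : IsPaleyWiener a (F + G) := by
  obtain ⟨f, hf, rfl⟩ := hF
  obtain ⟨g, hg, rfl⟩ := hG
  exact ⟨f + g, hf.add hg,
    (expTransform_add (integrable_of_memLp hf) (integrable_of_memLp hg)).symm⟩

theorem IsPaleyWiener.const_mul {a : ℝ} {F : ℂ → ℂ} (hF : IsPaleyWiener a F) (c : ℂ) :
    IsPaleyWiener a fun z => c * F z := by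
  obtain ⟨f, hf, rfl⟩ := hF
  exact ⟨fun x => c * f x, hf.const_mul c, (expTransform_const_mul a c f).symm⟩

theorem integrable_id_mul {a : ℝ} {f : ℝ → ℂ} (hf : Integrable f (symMeasure a)) :
    Integrable (fun x : ℝ => f x * (Complex.I * x)) (symMeasure a) := by
  refine hf.mul_bdd (c := Real.pi - a) (Continuous.aestronglyMeasurable (by fun_prop)) ?_
  refine ae_restrict_of_forall_mem measurableSet_Ioo fun x hx => ?_
  rw [norm_mul, Complex.norm_I, one_mul, Complex.norm_real]
  exact abs_le.2 ⟨by linarith [hx.1], hx.2.le⟩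

theorem hasDerivAt_expTransform {a : ℝ} {f : ℝ → ℂ} (hf : Integrable f (symMeasure a)) (z : ℂ) :
    HasDerivAt (expTransform a f) (expTransform a (fun x => f x * (Complex.I * x)) z) z := by
  refine (hasDerivAt_integral_of_dominated_loc_of_deriv_le
    (F := fun z x => f x * Complex.exp (Complex.I * z * x))
    (F' := fun z x => f x * (Complex.I * x) * Complex.exp (Complex.I * z * x))
    (bound := fun x => ‖f x * (Complex.I * x)‖ * Real.exp ((|z.im| + 1) * (Real.pi - a)))
    (Metric.ball_mem_nhds z one_pos) (Eventually.of_forall fun w =>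
      (integrable_mul_cexp hf w).aestronglyMeasurable) (integrable_mul_cexp hf z)
    (integrable_mul_cexp (integrable_id_mul hf) z).aestronglyMeasurable ?_
    ((integrable_id_mul hf).norm.mul_const _) ?_).2
  · refine ae_restrict_of_forall_mem measurableSet_Ioo fun x hx w hw => ?_
    rw [norm_mul]
    refine mul_le_mul_of_nonneg_left (norm_cexp_le ?_ hx) (norm_nonneg _)
    have h1 : |(w - z).im| ≤ 1 :=
      (Complex.abs_im_le_norm _).trans (by simpa [dist_eq_norm] using (Metric.mem_ball.1 hw).le)
    rw [Complex.sub_im] at h1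
    have := abs_sub_abs_le_abs_sub w.im z.im
    linarith
  · refine Eventually.of_forall fun x w _ => ?_
    have h := (((hasDerivAt_id w).const_mul Complex.I).mul_const (x : ℂ)).cexp.const_mul (f x)
    simp only [id, mul_one] at h
    exact h.congr_deriv (by ring)

theorem differentiable_expTransform {a : ℝ} {f : ℝ → ℂ} (hf : Integrable f (symMeasure a)) :
    Differentiable ℂ (expTransform a f) := fun z =>
  (hasDerivAt_expTransform hf z).differentiableAt

theorem IsPaleyWiener.differentiable {a : ℝ} {F : ℂ → ℂ} (hF : IsPaleyWiener a F) :
    Differentiable ℂ F := by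
  obtain ⟨f, hf, rfl⟩ := hF
  exact differentiable_expTransform (integrable_of_memLp hf)

/-- Riemann–Lebesgue lemma on a horizontal line. -/
theorem tendsto_expTransform_line (a : ℝ) (f : ℝ → ℂ) (y : ℝ) :
    Tendsto (fun x : ℝ => expTransform a f (x + y * Complex.I)) (cocompact ℝ) (𝓝 0) := by
  have h := Real.tendsto_integral_exp_smul_cocompact
    ((Ioo (a - Real.pi) (Real.pi - a)).indicator
      fun x => f x * Complex.exp (Complex.I * (y * Complex.I) * x))
  -- On the line `Im z = y` the factor `exp (-y t)` is absorbed into the function; what remains is a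
  -- Fourier integral at frequency `-x / (2π)`.
  have h2 : Tendsto (fun x : ℝ => x * (-(2 * Real.pi)⁻¹)) (cocompact ℝ) (cocompact ℝ) :=
    (Homeomorph.mulRight₀ (-(2 * Real.pi)⁻¹)
      (by simp [Real.pi_ne_zero])).isClosedEmbedding.tendsto_cocompact
  refine (h.comp h2).congr fun x => ?_
  simp only [Function.comp_def, expTransform]
  rw [← integral_indicator measurableSet_Ioo]
  congr 1
  funext t
  by_cases ht : t ∈ Ioo (a - Real.pi) (Real.pi - a)
  · rw [indicator_of_mem ht, indicator_of_mem ht, Circle.smul_def, Real.fourierChar_apply,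
      smul_eq_mul, mul_left_comm, ← Complex.exp_add]
    congr 2
    have : (Real.pi : ℂ) ≠ 0 := by exact_mod_cast Real.pi_ne_zero
    push_cast
    field_simp
  · rw [indicator_of_notMem ht, indicator_of_notMem ht, smul_zero]

/-- Riemann–Lebesgue lemma, uniform on horizontal strips. -/
theorem exists_norm_expTransform_lt {a : ℝ} {f : ℝ → ℂ}
    (hf : Integrable f (symMeasure a)) (Y : ℝ) {ε : ℝ} (hε : 0 < ε) :
    ∃ R : ℝ, ∀ z : ℂ, |z.im| ≤ Y → R ≤ |z.re| → ‖expTransform a f z‖ < ε := by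
  set C := (∫ x, ‖f x * (Complex.I * x)‖ ∂symMeasure a) * Real.exp (Y * (Real.pi - a)) with hC
  have hC0 : 0 ≤ C := mul_nonneg (integral_nonneg fun _ => norm_nonneg _) (Real.exp_pos _).le
  have hconv : Convex ℝ {z : ℂ | |z.im| ≤ Y} := by
    have : {z : ℂ | |z.im| ≤ Y} = Complex.imLm ⁻¹' (Icc (-Y) Y) := by
      ext z; simp [abs_le]
    rw [this]
    exact (convex_Icc _ _).linear_preimage _
  have hlip : ∀ z w : ℂ, |z.im| ≤ Y → |w.im| ≤ Y →
      ‖expTransform a f w - expTransform a f z‖ ≤ C * ‖w - z‖ := fun z w hz hw =>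
    hconv.norm_image_sub_le_of_norm_deriv_le
      (fun x _ => (hasDerivAt_expTransform hf x).differentiableAt)
      (fun x hx => by
        rw [(hasDerivAt_expTransform hf x).deriv]
        exact norm_expTransform_le (integrable_id_mul hf) hx) hz hw
  -- Compactness of the range of `Im z`: the estimate on one line extends to nearby lines by the
  -- Lipschitz bound `C`.
  have main : ∃ R : ℝ, ∀ z : ℂ, z.im ∈ Icc (-Y) Y → R ≤ |z.re| → ‖expTransform a f z‖ < ε := by
    refine isCompact_Icc.induction_on (s := Icc (-Y) Y)
      (p := fun s => ∃ R : ℝ, ∀ z : ℂ, z.im ∈ s → R ≤ |z.re| → ‖expTransform a f z‖ < ε)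
      ⟨0, by simp⟩ ?_ ?_ ?_
    · rintro s t hst ⟨R, hR⟩
      exact ⟨R, fun z hz => hR z (hst hz)⟩
    · rintro s t ⟨R, hR⟩ ⟨R', hR'⟩
      refine ⟨max R R', fun z hz hr => ?_⟩
      rcases hz with hz | hz
      · exact hR z hz ((le_max_left _ _).trans hr)
      · exact hR' z hz ((le_max_right _ _).trans hr)
    · intro y hy
      have h := (tendsto_expTransform_line a f y).eventually
        (Metric.ball_mem_nhds (0 : ℂ) (half_pos hε))
      rw [← Metric.cobounded_eq_cocompact, ← comap_norm_atTop, eventually_comap,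
        eventually_atTop] at h
      obtain ⟨R, hR⟩ := h
      refine ⟨Icc (-Y) Y ∩ Metric.ball y (ε / (2 * (C + 1))),
        inter_mem_nhdsWithin _ (Metric.ball_mem_nhds _ (by positivity)), R, fun z hz hr => ?_⟩
      have h1 : ‖expTransform a f (z.re + y * Complex.I)‖ < ε / 2 := by
        simpa using hR _ hr z.re rfl
      have h2 := hlip (z.re + y * Complex.I) z (by simpa [abs_le] using hy)
        (abs_le.2 hz.1)
      have h3 : ‖z - (z.re + y * Complex.I)‖ = |z.im - y| := by
        have : z - (z.re + y * Complex.I) = ((z.im - y : ℝ) : ℂ) * Complex.I := by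
          apply Complex.ext <;> simp
        rw [this, norm_mul, Complex.norm_I, mul_one, Complex.norm_real, Real.norm_eq_abs]
      have h4 : |z.im - y| < ε / (2 * (C + 1)) := by
        simpa [Real.dist_eq] using hz.2
      have h5 : C * |z.im - y| ≤ ε / 2 := by
        calc C * |z.im - y| ≤ (C + 1) * (ε / (2 * (C + 1))) := by gcongr; linarith
          _ = ε / 2 := by field_simp
      rw [h3] at h2
      have h6 := norm_add_le (expTransform a f z - expTransform a f (z.re + y * Complex.I))
        (expTransform a f (z.re + y * Complex.I))
      rw [sub_add_cancel] at h6
      linarith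
  obtain ⟨R, hR⟩ := main
  exact ⟨R, fun z hz => hR z (abs_le.1 hz)⟩

theorem expTransform_eq_intervalIntegral {a : ℝ} (ha : a < Real.pi) (f : ℝ → ℂ) (z : ℂ) :
    expTransform a f z =
      ∫ x in (a - Real.pi)..(Real.pi - a), f x * Complex.exp (Complex.I * z * x) := by
  rw [intervalIntegral.integral_of_le (by linarith), integral_Ioc_eq_integral_Ioo]
  rfl

theorem intervalIntegrable_of_integrable {a : ℝ} (ha : a < Real.pi) {f : ℝ → ℂ}
    (hf : Integrable f (symMeasure a)) :
    IntervalIntegrable f volume (a - Real.pi) (Real.pi - a) :=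
  (intervalIntegrable_iff_integrableOn_Ioo_of_le (by linarith)).2 hf

/-- Division by a zero preserves the Paley–Wiener class. -/
theorem IsPaleyWiener.exists_eq_sub_mul {a : ℝ} (ha : a < Real.pi) {F : ℂ → ℂ}
    (hF : IsPaleyWiener a F) {ν : ℂ} (hν : F ν = 0) :
    ∃ G, IsPaleyWiener a G ∧ ∀ z, F z = (z - ν) * G z := by
  obtain ⟨f, hf, rfl⟩ := hF
  have hfi := integrable_of_memLp hf
  set b := Real.pi - a with hb
  have hb' : a - Real.pi = -b := by rw [hb]; ring
  have hb0 : 0 < b := by rw [hb]; linarith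
  have hφ : IntervalIntegrable (fun x : ℝ => f x * Complex.exp (Complex.I * ν * x)) volume
      (a - Real.pi) b := intervalIntegrable_of_integrable ha (integrable_mul_cexp hfi ν)
  -- The primitive `h` vanishes at both ends because `F ν = 0`. Integrating `exp (i(z - ν)x)` by
  -- parts against `h'` gives `F z = -i (z - ν) ∫ h exp (i(z - ν)x)`, whence the density `g` of the
  -- quotient.
  set h : ℝ → ℂ := fun x => ∫ t in (a - Real.pi)..x, f t * Complex.exp (Complex.I * ν * t) with hh
  have hAC : AbsolutelyContinuousOnInterval h (a - Real.pi) b :=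
    absolutelyContinuous_primitive hφ left_mem_uIcc
  have hd := hφ.ae_hasDerivAt_integral
  have hend : h b = 0 := by
    rw [hh]
    rw [expTransform_eq_intervalIntegral ha] at hν
    exact hν
  have hle : a - Real.pi ≤ b := by rw [hb']; linarith
  set g : ℝ → ℂ := fun x => -Complex.I * h x * Complex.exp (-(Complex.I * ν) * x) with hg
  have hgc : ContinuousOn g (Icc (a - Real.pi) b) := by
    have := hAC.continuousOn
    rw [uIcc_of_le hle] at this
    refine (continuousOn_const.mul this).mul (Continuous.continuousOn (by fun_prop))
  have hgL : MemLp g 2 (symMeasure a) := by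
    obtain ⟨C, hC⟩ := isCompact_Icc.exists_bound_of_continuousOn hgc
    refine MemLp.of_bound ((hgc.mono Ioo_subset_Icc_self).aestronglyMeasurable measurableSet_Ioo)
      C (ae_restrict_of_forall_mem measurableSet_Ioo fun x hx => hC x (Ioo_subset_Icc_self hx))
  refine ⟨expTransform a g, ⟨g, hgL, rfl⟩, fun z => ?_⟩
  set K : ℝ → ℂ := fun x => h x * Complex.exp (Complex.I * (z - ν) * x) with hK
  have hKAC : AbsolutelyContinuousOnInterval K (a - Real.pi) b :=
    hAC.smul (absolutelyContinuous_of_contDiff (contDiff_cexp_mul _) _ _)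
  have hfz := intervalIntegrable_of_integrable ha (integrable_mul_cexp hfi z)
  have hgz := intervalIntegrable_of_integrable ha (integrable_mul_cexp (integrable_of_memLp hgL) z)
  have key := integral_eq_sub_of_absolutelyContinuous hKAC
    (f' := fun x => f x * Complex.exp (Complex.I * z * x) -
      (z - ν) * (g x * Complex.exp (Complex.I * z * x)))
    (hfz.sub (hgz.const_mul _)) (by
      filter_upwards [hd] with x hx hxm
      have h1 := (hx hxm _ left_mem_uIcc).mul (hasDerivAt_cexp_mul (Complex.I * (z - ν)) x)
      refine h1.congr_deriv ?_
      have e1 : Complex.exp (Complex.I * z * x) =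
          Complex.exp (Complex.I * ν * x) * Complex.exp (Complex.I * (z - ν) * x) := by
        rw [← Complex.exp_add]; ring_nf
      have e2 : Complex.exp (-(Complex.I * ν) * x) * Complex.exp (Complex.I * ν * x) = 1 := by
        rw [← Complex.exp_add]; simp
      rw [e1]
      have e3 : -Complex.I * h x * Complex.exp (-(Complex.I * ν) * x) *
          (Complex.exp (Complex.I * ν * x) * Complex.exp (Complex.I * (z - ν) * x)) =
          -Complex.I * h x * Complex.exp (Complex.I * (z - ν) * x) := by
        linear_combination (-Complex.I * h x * Complex.exp (Complex.I * (z - ν) * x)) * e2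
      rw [e3]
      ring) right_mem_uIcc
  rw [intervalIntegral.integral_sub hfz (hgz.const_mul _), intervalIntegral.integral_const_mul,
    ← expTransform_eq_intervalIntegral ha, ← expTransform_eq_intervalIntegral ha] at key
  simp only [hK, hend] at key
  simp only [hh, intervalIntegral.integral_same, zero_mul, sub_zero] at key
  linear_combination key

/-! ### Replacing nodes one at a time -/

/-- `F` vanishes at the nodes `ν k`, `k ∈ S`, counted with multiplicity. -/
def VanishesOn {ι : Type*} (F : ℂ → ℂ) (ν : ι → ℂ) (S : Set ι) : Prop :=
  ∀ z, {k | k ∈ S ∧ ν k = z}.encard ≤ analyticOrderAt F z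

section Nodes

variable {ι : Type*} {F G : ℂ → ℂ} {ν ν' : ι → ℂ} {S T : Set ι} {i : ι}

theorem VanishesOn.mono (h : VanishesOn F ν T) (hST : S ⊆ T) : VanishesOn F ν S := fun z =>
  (encard_le_encard (t := {k | k ∈ T ∧ ν k = z}) fun _ hk => ⟨hST hk.1, hk.2⟩).trans (h z)

theorem VanishesOn.congr (h : VanishesOn F ν S) (hν : ∀ k ∈ S, ν k = ν' k) :
    VanishesOn F ν' S := fun z => by
  refine (encard_le_encard (t := {k | k ∈ S ∧ ν k = z}) fun k hk => ?_).trans (h z)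
  exact ⟨hk.1, (hν k hk.1).trans hk.2⟩

theorem VanishesOn.apply_eq_zero (h : VanishesOn F ν S) (hi : i ∈ S) : F (ν i) = 0 := by
  refine apply_eq_zero_of_analyticOrderAt_ne_zero fun h0 => ?_
  have := h (ν i)
  rw [h0, nonpos_iff_eq_zero, encard_eq_zero] at this
  exact this.le (show i ∈ {k | k ∈ S ∧ ν k = ν i} from ⟨hi, rfl⟩)

theorem vanishesOn_of_injOn (hF : Differentiable ℂ F) (hν : InjOn ν S)
    (h : ∀ k ∈ S, F (ν k) = 0) : VanishesOn F ν S := fun z => by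
  by_cases hz : ∃ k ∈ S, ν k = z
  · obtain ⟨k, hk, rfl⟩ := hz
    have h1 : {l | l ∈ S ∧ ν l = ν k}.encard ≤ 1 :=
      encard_le_one_iff.2 fun x y hx hy => hν hx.1 hy.1 (hx.2.trans hy.2.symm)
    exact h1.trans (Order.one_le_iff_ne_zero.2
      ((hF.analyticAt _).analyticOrderAt_ne_zero.2 (h k hk)))
  · have : {k | k ∈ S ∧ ν k = z} = ∅ :=
      eq_empty_of_forall_notMem fun k hk => hz ⟨k, hk⟩
    simp [this]

theorem analyticOrderAt_sub_mul (hG : Differentiable ℂ G) (ν w : ℂ) :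
    analyticOrderAt (fun z => (z - ν) * G z) w =
      (if ν = w then 1 else 0) + analyticOrderAt G w := by
  have h := analyticOrderAt_mul (f := (· - ν)) (g := G) (z₀ := w) (by fun_prop) (hG.analyticAt w)
  have h' : ((· - ν) * G : ℂ → ℂ) = fun z => (z - ν) * G z := rfl
  rw [h'] at h
  rw [h]
  split_ifs with hw
  · subst hw; simp
  · rw [analyticOrderAt_id_sub_const_of_ne (Ne.symm hw)]

/-- The factor `z - ν i` raises the order at `ν i` by exactly one, which pays for exactly the added
node, even if other nodes coincide with it. -/
theorem vanishesOn_insert (hG : Differentiable ℂ G) (hi : i ∉ S) :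
    VanishesOn (fun z => (z - ν i) * G z) ν (insert i S) ↔ VanishesOn G ν S := by
  refine forall_congr' fun w => ?_
  rw [analyticOrderAt_sub_mul hG]
  split_ifs with hw
  · have : {k | k ∈ insert i S ∧ ν k = w} = insert i {k | k ∈ S ∧ ν k = w} := by
      ext k
      simp only [mem_insert_iff, mem_ofPred_eq]
      constructor
      · rintro ⟨rfl | h, h'⟩
        · exact Or.inl rfl
        · exact Or.inr ⟨h, h'⟩
      · rintro (rfl | ⟨h, h'⟩)
        · exact ⟨Or.inl rfl, hw⟩
        · exact ⟨Or.inr h, h'⟩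
    rw [this, encard_insert_of_notMem fun h => hi h.1, add_comm]
    exact ENat.add_le_add_iff_left (by simp)
  · have : {k | k ∈ insert i S ∧ ν k = w} = {k | k ∈ S ∧ ν k = w} := by
      ext k
      simp only [mem_insert_iff, mem_ofPred_eq]
      constructor
      · rintro ⟨rfl | h, h'⟩
        · exact absurd h' hw
        · exact ⟨h, h'⟩
      · rintro ⟨h, h'⟩
        exact ⟨Or.inr h, h'⟩
    rw [this, zero_add]

theorem VanishesOn.add_const_mul (hG : Differentiable ℂ G)
    (h : VanishesOn F ν S) (h' : VanishesOn G ν S) (c : ℂ) :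
    VanishesOn (F + fun z => c * G z) ν S := fun z => by
  refine le_trans (le_min (h z) ?_) le_analyticOrderAt_add
  have := analyticOrderAt_mul (f := fun _ => c) (g := G) (z₀ := z) analyticAt_const
    (hG.analyticAt z)
  have e : ((fun _ => c) * G : ℂ → ℂ) = fun z => c * G z := rfl
  rw [← e, this]
  exact (h' z).trans le_add_self

/-- Interpolation by Paley–Wiener functions at the nodes `ν` is uniquely solvable, in the sense
needed for perturbing a single node; `s` is the function to be interpolated, up to the sign. -/
structure IsInterpolating (a : ℝ) (s : ℂ → ℂ) (ν : ι → ℂ) : Prop where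
  unique : ∀ F, IsPaleyWiener a F → VanishesOn F ν univ → F = 0
  dual : ∀ i, ∃ G, IsPaleyWiener a G ∧ G ≠ 0 ∧ VanishesOn G ν {i}ᶜ
  exists_eq : ∃ F, IsPaleyWiener a F ∧ VanishesOn (s + F) ν univ

theorem eq_zero_of_sub_mul_eq_zero (hG : Differentiable ℂ G) {w : ℂ}
    (h : (fun z => (z - w) * G z) = 0) : G = 0 := by
  have h1 : EqOn G 0 {w}ᶜ := fun z hz => by
    have := congrFun h z
    simpa [sub_eq_zero, show z ≠ w from hz] using this
  exact h1.closure hG.continuous continuous_const |>.mono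
    (by rw [closure_compl_singleton]) |> (eqOn_univ _ _).1

/-- Moving a zero from `w` to `w'` adds only a multiple of the quotient `G`, which is itself in the
class. -/
theorem IsPaleyWiener.sub_mul {a : ℝ} (hF : IsPaleyWiener a F) (hG : IsPaleyWiener a G) {w : ℂ}
    (h : ∀ z, F z = (z - w) * G z) (w' : ℂ) : IsPaleyWiener a fun z => (z - w') * G z := by
  have : (fun z => (z - w') * G z) = F + fun z => (w - w') * G z := by
    funext z
    simp only [Pi.add_apply, h z]
    ring
  rw [this]
  exact hF.add (hG.const_mul _)

/-- Moving the zero `ν i` to `μ` within the Paley–Wiener class carries over uniqueness and the dual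
functions of the other indices; the dual function of `i` ignores the node `i`. The interpolant for
the old nodes is corrected by a multiple of that dual function `G`, which vanishes at all nodes but
the moved one. -/
theorem IsInterpolating.update [DecidableEq ι] {a : ℝ} (ha : a < Real.pi) {s : ℂ → ℂ}
    (hs : Differentiable ℂ s) (h : IsInterpolating a s ν) (i : ι) (μ : ℂ) :
    IsInterpolating a s (Function.update ν i μ) := by
  set ν' := Function.update ν i μ with hν'
  have hi : ν' i = μ := Function.update_self ..
  have hk : ∀ S : Set ι, i ∉ S → ∀ k ∈ S, ν k = ν' k := fun S hS k hkS =>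
    (Function.update_of_ne (ne_of_mem_of_not_mem hkS hS) _ _).symm
  have huniv : (univ : Set ι) = insert i {i}ᶜ := by ext; simp [em]
  have hii : i ∉ ({i}ᶜ : Set ι) := by simp
  have uniq : ∀ F, IsPaleyWiener a F → VanishesOn F ν' univ → F = 0 := by
    intro F hF hV
    obtain ⟨G, hG, hFG⟩ := hF.exists_eq_sub_mul ha (hV.apply_eq_zero (mem_univ i))
    have hF' : F = fun z => (z - ν' i) * G z := funext hFG
    have hV' := hV
    rw [hF', huniv, vanishesOn_insert hG.differentiable hii] at hV'
    have hV2 : VanishesOn G ν {i}ᶜ := hV'.congr fun k hk' => (hk _ hii k hk').symm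
    have h0 := h.unique _ (hF.sub_mul hG hFG (ν i))
      (by rw [huniv, vanishesOn_insert hG.differentiable hii]; exact hV2)
    have := eq_zero_of_sub_mul_eq_zero hG.differentiable h0
    rw [hF', this]
    funext z
    simp
  refine ⟨uniq, fun k => ?_, ?_⟩
  · by_cases hki : k = i
    · obtain ⟨G, hG, hG0, hV⟩ := h.dual i
      subst hki
      exact ⟨G, hG, hG0, hV.congr (hk _ hii)⟩
    · obtain ⟨G, hG, hG0, hV⟩ := h.dual k
      have hset : ({k}ᶜ : Set ι) = insert i ({k, i}ᶜ) := by
        ext l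
        by_cases hl : l = i
        · subst hl; simp [Ne.symm hki]
        · simp [hl]
      have hi' : i ∉ ({k, i}ᶜ : Set ι) := by simp
      obtain ⟨H, hH, hGH⟩ := hG.exists_eq_sub_mul ha
        (hV.apply_eq_zero (i := i) (by simp [Ne.symm hki]))
      have hG' : G = fun z => (z - ν i) * H z := funext hGH
      refine ⟨fun z => (z - ν' i) * H z, hG.sub_mul hH hGH _, fun h0 => hG0 ?_, ?_⟩
      · rw [hG', eq_zero_of_sub_mul_eq_zero hH.differentiable h0]
        funext z
        simp
      · rw [hG', hset, vanishesOn_insert hH.differentiable hi'] at hV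
        rw [hset, vanishesOn_insert hH.differentiable hi']
        exact hV.congr (hk _ hi')
  · obtain ⟨F, hF, hV⟩ := h.exists_eq
    obtain ⟨G, hG, hG0, hVG⟩ := h.dual i
    have hVG' : VanishesOn G ν' {i}ᶜ := hVG.congr (hk _ hii)
    have hV' : VanishesOn (s + F) ν' {i}ᶜ := (hV.mono (subset_univ _)).congr (hk _ hii)
    have hfd : Differentiable ℂ (s + F) := hs.add hF.differentiable
    have hGtop : analyticOrderAt G μ ≠ ⊤ := fun h =>
      hG0 ((AnalyticOnNhd.analyticOrderAt_eq_top_iff_eq_zero μ fun z => hG.differentiable.analyticAt z).1 h)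
    have hset : ∀ w, w ≠ μ → {k | k ∈ univ ∧ ν' k = w} = {k | k ∈ ({i}ᶜ : Set ι) ∧ ν' k = w} := by
      intro w hw
      ext k
      simp only [mem_univ, true_and, mem_ofPred_eq, mem_compl_iff, mem_singleton_iff]
      refine ⟨fun hk' => ⟨?_, hk'⟩, fun hk' => hk'.2⟩
      rintro rfl
      exact hw (hk'.symm.trans hi)
    have hsetμ : {k | k ∈ univ ∧ ν' k = μ}.encard
        = {k | k ∈ ({i}ᶜ : Set ι) ∧ ν' k = μ}.encard + 1 := by
      rw [← encard_insert_of_notMem (a := i) (by simp)]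
      congr 1
      ext k
      by_cases hki : k = i
      · subst hki; simp [hi]
      · simp [hki]
    obtain ⟨r, hr⟩ := ENat.ne_top_iff_exists.1 (ne_top_of_le_ne_top hGtop (hVG' μ))
    -- Here `r` counts the other nodes sitting at `μ`. If the order of `G` exceeded `r`, then `G`
    -- would vanish at all new nodes and be zero by uniqueness.
    have hGr : analyticOrderAt G μ = r := by
      refine le_antisymm ?_ (hr ▸ hVG' μ)
      by_contra! hlt
      refine hG0 (uniq G hG fun w => ?_)
      by_cases hw : w = μ
      · subst hw
        rw [hsetμ, ← hr]
        exact Order.add_one_le_of_lt hlt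
      · rw [hset w hw]; exact hVG' w
    obtain ⟨G1, hG1, hG1μ, hGe⟩ :=
      ((hG.differentiable.analyticAt μ).analyticOrderAt_eq_natCast).1 hGr
    obtain ⟨f1, hf1, hfe⟩ := (natCast_le_analyticOrderAt (hfd.analyticAt μ)).1 (hr ▸ hV' μ)
    -- Near `μ` the functions are `(z - μ)^r f1` and `(z - μ)^r G1` with `G1 μ ≠ 0`; this `c`
    -- cancels the coefficient of `(z - μ)^r` and gains the missing order.
    set c : ℂ := -f1 μ / G1 μ with hc
    refine ⟨F + fun z => c * G z, hF.add (hG.const_mul c), fun w => ?_⟩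
    rw [← add_assoc]
    by_cases hw : w = μ
    · subst hw
      rw [hsetμ, ← hr]
      have he : (s + F + fun z => c * G z) =ᶠ[𝓝 w]
          ((· - w) ^ r) * (f1 + fun z => c * G1 z) := by
        filter_upwards [hGe, hfe] with z h1 h2
        simp only [Pi.add_apply, Pi.mul_apply, Pi.pow_apply, smul_eq_mul] at h1 h2 ⊢
        rw [h1, h2]
        ring
      have ha1 : AnalyticAt ℂ (f1 + fun z => c * G1 z) w := hf1.add (analyticAt_const.mul hG1)
      rw [analyticOrderAt_congr he, analyticOrderAt_mul (by fun_prop) ha1,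
        analyticOrderAt_centeredMonomial]
      refine add_le_add le_rfl (Order.one_le_iff_ne_zero.2 (ha1.analyticOrderAt_ne_zero.2 ?_))
      simp only [Pi.add_apply, hc]
      field_simp
      ring
    · rw [hset w hw]
      exact hV'.add_const_mul hG.differentiable hVG' c w

/-- Finitely many nodes may be replaced arbitrarily. -/
theorem IsInterpolating.congr_finite [DecidableEq ι] {a : ℝ} (ha : a < Real.pi) {s : ℂ → ℂ}
    (hs : Differentiable ℂ s) (S : Finset ι) :
    ∀ {ν ν' : ι → ℂ}, IsInterpolating a s ν → (∀ k ∉ S, ν k = ν' k) →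
      IsInterpolating a s ν' := by
  induction S using Finset.induction_on with
  | empty =>
    intro ν ν' h hν
    rwa [← funext fun k => hν k (by simp)]
  | insert i S _ ih =>
    intro ν ν' h hν
    refine ih (h.update ha hs i (ν' i)) fun k hk => ?_
    by_cases hki : k = i
    · subst hki; simp
    · rw [Function.update_of_ne hki]
      exact hν k (by simp [hki, hk])

end Nodes

/-! ### Perturbation of Riesz bases -/

theorem memℓp_two_iff {ι : Type*} {f : ι → ℂ} : Memℓp f 2 ↔ Summable fun k => ‖f k‖ ^ 2 := by
  rw [memℓp_gen_iff (by norm_num)]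
  norm_num

section RieszBasis

variable {ι H : Type*} [DecidableEq ι] [NormedAddCommGroup H] [InnerProductSpace ℂ H]

/-- A square summable family of vectors defines a bounded synthesis operator on `ℓ²`. -/
theorem exists_synthesis [CompleteSpace H] {d : ι → H} (hd : Summable fun k => ‖d k‖ ^ 2) :
    ∃ D : lp (fun _ : ι => ℂ) 2 →L[ℂ] H, (∀ k, D (lp.single 2 k 1) = d k) ∧
      ‖D‖ ≤ √(∑' k, ‖d k‖ ^ 2) := by
  have hpq : Real.HolderConjugate 2 2 := by constructor <;> norm_num
  have hc2 : ∀ c : lp (fun _ : ι => ℂ) 2, Summable fun k => ‖c k‖ ^ (2 : ℝ) := fun c => by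
    simpa using (memℓp_gen_iff (by norm_num)).1 (lp.memℓp c)
  have hd2 : Summable fun k => ‖d k‖ ^ (2 : ℝ) := by simpa using hd
  have hs : ∀ c : lp (fun _ : ι => ℂ) 2, Summable fun k => ‖c k • d k‖ := fun c => by
    simp only [norm_smul]
    exact Real.summable_mul_of_Lp_Lq_of_nonneg hpq (fun _ => norm_nonneg _)
      (fun _ => norm_nonneg _) (hc2 c) hd2
  let D₀ : lp (fun _ : ι => ℂ) 2 →ₗ[ℂ] H :=
    { toFun := fun c => ∑' k, c k • d k
      map_add' := fun c c' => by
        simp only [lp.coeFn_add, Pi.add_apply, add_smul]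
        exact (hs c).of_norm.tsum_add (hs c').of_norm
      map_smul' := fun r c => by
        simp only [lp.coeFn_smul, Pi.smul_apply, smul_assoc, RingHom.id_apply]
        exact (hs c).of_norm.tsum_const_smul r }
  have hbound : ∀ c, ‖D₀ c‖ ≤ √(∑' k, ‖d k‖ ^ 2) * ‖c‖ := fun c => by
    refine (norm_tsum_le_tsum_norm (hs c)).trans ?_
    simp only [norm_smul]
    refine (Real.inner_le_Lp_mul_Lq_tsum_of_nonneg hpq (fun _ => norm_nonneg _)
      (fun _ => norm_nonneg _) (hc2 c) hd2).trans (le_of_eq ?_)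
    have h1 := lp.norm_rpow_eq_tsum (p := 2) (by norm_num) c
    simp only [ENNReal.toReal_ofNat] at h1
    rw [← h1, mul_comm, ← Real.rpow_mul (norm_nonneg _), Real.sqrt_eq_rpow]
    norm_num
  refine ⟨D₀.mkContinuous _ hbound, fun k => ?_, D₀.mkContinuous_norm_le (Real.sqrt_nonneg _) _⟩
  change ∑' l, (lp.single 2 k (1 : ℂ) : lp (fun _ : ι => ℂ) 2) l • d l = d k
  rw [tsum_eq_single k fun l hl => by simp [lp.single_apply, hl]]
  simp [lp.single_apply]

/-- The synthesis operator of `v` differs from that of `e` by one of norm at most the square root of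
the sum, and invertible operators form an open set. -/
theorem IsRieszBasis.exists_perturbation [CompleteSpace H] {e : ι → H} (h : IsRieszBasis e) :
    ∃ ε > 0, ∀ v : ι → H, Summable (fun k => ‖v k - e k‖ ^ 2) →
      ∑' k, ‖v k - e k‖ ^ 2 < ε → IsRieszBasis v := by
  obtain ⟨T, hT⟩ := h
  obtain ⟨δ, hδ, hball⟩ := Metric.mem_nhds_iff.1 T.nhds
  refine ⟨δ ^ 2, by positivity, fun v hv hlt => ?_⟩
  obtain ⟨D, hD, hDn⟩ := exists_synthesis hv
  have hmem : (T : lp (fun _ : ι => ℂ) 2 →L[ℂ] H) + D ∈ Metric.ball (T : _ →L[ℂ] H) δ := by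
    rw [Metric.mem_ball, dist_eq_norm, add_sub_cancel_left]
    refine hDn.trans_lt ?_
    rwa [Real.sqrt_lt' hδ]
  obtain ⟨T', hT'⟩ := hball hmem
  refine ⟨T', fun k => ?_⟩
  have := congrArg (fun A : lp (fun _ : ι => ℂ) 2 →L[ℂ] H => A (lp.single 2 k 1)) hT'
  simp only [ContinuousLinearEquiv.coe_coe, add_apply, hT, hD] at this
  rw [this]
  abel

/-- A quadratically close family becomes a Riesz basis after replacing finitely many vectors. -/
theorem IsRieszBasis.eventually_perturbation [CompleteSpace H] {e v : ι → H} (h : IsRieszBasis e)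
    (hv : Summable fun k => ‖v k - e k‖ ^ 2) :
    ∀ᶠ S : Finset ι in atTop, IsRieszBasis fun k => if k ∈ S then e k else v k := by
  obtain ⟨ε, hε, hp⟩ := h.exists_perturbation
  filter_upwards [(tendsto_tsum_compl_atTop_zero fun k => ‖v k - e k‖ ^ 2).eventually
    (gt_mem_nhds hε)] with S hS
  have heq : (fun k => ‖(if k ∈ S then e k else v k) - e k‖ ^ 2) =
      {k | k ∉ S}.indicator fun k => ‖v k - e k‖ ^ 2 := by
    funext k
    by_cases hk : k ∈ S <;> simp [hk]
  refine hp _ (heq ▸ hv.indicator _) ?_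
  rw [heq, ← tsum_subtype]
  exact hS

/-- The moment problem is solved by the adjoint of `T⁻¹`; the data are conjugated because the inner
product is conjugate-linear in its first argument. -/
theorem IsRieszBasis.exists_inner_eq [CompleteSpace H] {v : ι → H} (h : IsRieszBasis v)
    {d : ι → ℂ} (hd : Memℓp d 2) : ∃ f : H, ∀ k, inner ℂ f (v k) = d k := by
  obtain ⟨T, hT⟩ := h
  have hd' : Memℓp (fun k => (starRingEnd ℂ) (d k)) 2 := by
    rw [memℓp_two_iff] at hd ⊢
    simpa using hd
  refine ⟨ContinuousLinearMap.adjoint (T.symm : H →L[ℂ] lp (fun _ : ι => ℂ) 2) ⟨_, hd'⟩,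
    fun k => ?_⟩
  rw [ContinuousLinearMap.adjoint_inner_left, ← hT k]
  simp [lp.inner_single_right]

theorem IsRieszBasis.eq_zero_of_inner_eq_zero [CompleteSpace H] {v : ι → H} (h : IsRieszBasis v)
    {f : H} (hf : ∀ k, inner ℂ f (v k) = 0) : f = 0 := by
  obtain ⟨T, hT⟩ := h
  set c := ContinuousLinearMap.adjoint (T : lp (fun _ : ι => ℂ) 2 →L[ℂ] H) f with hc
  have hc0 : c = 0 := by
    ext k
    have h1 : inner ℂ c (lp.single 2 k (1 : ℂ) : lp (fun _ : ι => ℂ) 2) = 0 := by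
      rw [hc, ContinuousLinearMap.adjoint_inner_left]
      simpa [hT] using hf k
    rw [lp.inner_single_right] at h1
    simpa using h1
  have h2 : inner ℂ f (T (T.symm f)) = 0 := by
    have := ContinuousLinearMap.adjoint_inner_left (T : lp (fun _ : ι => ℂ) 2 →L[ℂ] H) (T.symm f) f
    rw [← hc, hc0, inner_zero_left] at this
    exact this.symm
  rw [T.apply_symm_apply] at h2
  exact inner_self_eq_zero.1 h2

end RieszBasis

/-! ### Elementary estimates -/

theorem norm_exp_sub_one_le_mul_exp (w : ℂ) : ‖Complex.exp w - 1‖ ≤ Real.exp ‖w‖ * ‖w‖ := by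
  have h := (convex_closedBall (0 : ℂ) ‖w‖).norm_image_sub_le_of_norm_deriv_le
    (f := Complex.exp) (C := Real.exp ‖w‖) (fun _ _ => Complex.differentiableAt_exp)
    (fun z hz => by
      rw [Complex.deriv_exp]
      exact (Complex.norm_exp_le_exp_norm z).trans (Real.exp_le_exp.2 (by simpa using hz)))
    (x := 0) (y := w) (by simp) (by simp)
  simpa using h

theorem norm_sin_le_mul_exp (w : ℂ) : ‖Complex.sin w‖ ≤ Real.exp ‖w‖ * ‖w‖ := by
  have h1 := norm_exp_sub_one_le_mul_exp (-w * Complex.I)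
  have h2 := norm_exp_sub_one_le_mul_exp (w * Complex.I)
  have h3 : Complex.sin w = ((Complex.exp (-w * Complex.I) - 1) -
    (Complex.exp (w * Complex.I) - 1)) * Complex.I / 2 := by
    rw [Complex.sin]; ring
  rw [h3, norm_div, norm_mul, Complex.norm_I, mul_one]
  simp only [norm_mul, norm_neg, Complex.norm_I, mul_one] at h1 h2
  have h4 := norm_sub_le (Complex.exp (-w * Complex.I) - 1) (Complex.exp (w * Complex.I) - 1)
  have : ‖(2 : ℂ)‖ = 2 := by norm_num
  rw [this]
  linarith

/-- The function `z ↦ sin (π z)`. -/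
def sinPi (z : ℂ) : ℂ := Complex.sin (Real.pi * z)

theorem differentiable_sinPi : Differentiable ℂ sinPi :=
  Complex.differentiable_sin.comp (differentiable_id.const_mul _)

theorem sinPi_int_add (m : ℤ) (z : ℂ) : sinPi (m + z) = (-1) ^ m * sinPi z := by
  have h := Complex.sin_antiperiodic.add_int_mul_eq (x := Real.pi * z) m
  rw [sinPi, sinPi, mul_add, add_comm, mul_comm (Real.pi : ℂ) (m : ℂ), h, Int.cast_negOnePow]

theorem norm_sinPi_int_add (m : ℤ) (z : ℂ) : ‖sinPi (m + z)‖ = ‖sinPi z‖ := by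
  rw [sinPi_int_add, norm_mul]
  rcases Int.even_or_odd m with h | h <;> simp [h.neg_one_zpow]

theorem exists_bound_of_memℓp {ι : Type*} {κ : ι → ℂ} (hκ : Memℓp κ 2) :
    ∃ C : ℝ, ∀ k, ‖κ k‖ ≤ C := by
  obtain ⟨C, hC⟩ := (memℓp_infty_iff.1 (hκ.of_exponent_ge le_top))
  exact ⟨C, fun k => hC ⟨k, rfl⟩⟩

theorem Memℓp.of_norm_le_mul {ι : Type*} {κ κ' : ι → ℂ} (hκ : Memℓp κ 2) (C : ℝ)
    (h : ∀ k, ‖κ' k‖ ≤ C * ‖κ k‖) : Memℓp κ' 2 := by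
  rw [memℓp_two_iff] at *
  refine Summable.of_nonneg_of_le (fun k => by positivity) (fun k => ?_) (hκ.mul_left (C ^ 2))
  rw [← mul_pow]
  exact pow_le_pow_left₀ (norm_nonneg _) (h k) 2

/-! ### Exponentials with perturbed frequencies -/

theorem memLp_cexp (a : ℝ) (z : ℂ) :
    MemLp (fun x : ℝ => Complex.exp (Complex.I * z * x)) 2 (symMeasure a) :=
  MemLp.of_bound (aestronglyMeasurable_cexp z) _ (ae_norm_cexp_le a z)

/-- The exponential `x ↦ exp (i z x)` as an element of `L₂(a - π, π - a)`. -/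
def expLp (a : ℝ) (z : ℂ) : Lp ℂ 2 (symMeasure a) := (memLp_cexp a z).toLp _

theorem expSystem_eq (a : ℝ) (n : ℤ → ℤ) (k : ℤ) : expSystem a n k = expLp a (n k) := rfl

theorem inner_eq_expTransform {a : ℝ} (f : Lp ℂ 2 (symMeasure a)) (z : ℂ) :
    inner ℂ f (expLp a z) = expTransform a (fun x => (starRingEnd ℂ) (f x)) z := by
  rw [L2.inner_def, expTransform]
  refine integral_congr_ae ?_
  filter_upwards [(memLp_cexp a z).coeFn_toLp] with x hx
  rw [RCLike.inner_apply, expLp, hx, mul_comm]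

theorem IsPaleyWiener.exists_inner_eq {a : ℝ} {F : ℂ → ℂ} (hF : IsPaleyWiener a F) :
    ∃ f : Lp ℂ 2 (symMeasure a), ∀ z, F z = inner ℂ f (expLp a z) := by
  obtain ⟨f, hf, rfl⟩ := hF
  have hs : MemLp (fun x => (starRingEnd ℂ) (f x)) 2 (symMeasure a) := hf.star
  refine ⟨hs.toLp _, fun z => ?_⟩
  rw [inner_eq_expTransform, expTransform, expTransform]
  refine integral_congr_ae ?_
  filter_upwards [hs.coeFn_toLp] with x hx
  rw [hx, Complex.conj_conj]

theorem isPaleyWiener_inner {a : ℝ} (f : Lp ℂ 2 (symMeasure a)) :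
    IsPaleyWiener a fun z => inner ℂ f (expLp a z) :=
  ⟨_, (Lp.memLp f).star, funext fun z => inner_eq_expTransform f z⟩

/-- The constant does not depend on `m`, since the unimodular factor `exp (i m x)` can be taken out.
-/
theorem exists_norm_expLp_sub_le {a : ℝ} (ha : a < Real.pi) (K : ℝ) :
    ∃ C : ℝ, ∀ (m : ℤ) (δ : ℂ), ‖δ‖ ≤ K → ‖expLp a (m + δ) - expLp a m‖ ≤ C * ‖δ‖ := by
  set b := Real.pi - a with hb
  have hb0 : 0 < b := by rw [hb]; linarith
  refine ⟨(measureUnivNNReal (symMeasure a) : ℝ) ^ (2 : ENNReal).toReal⁻¹ *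
    (Real.exp (K * b) * b), fun m δ hδ => ?_⟩
  rw [mul_assoc]
  refine Lp.norm_le_of_ae_bound (by positivity) ?_
  filter_upwards [Lp.coeFn_sub (expLp a (m + δ)) (expLp a m), (memLp_cexp a (m + δ)).coeFn_toLp,
    (memLp_cexp a m).coeFn_toLp, ae_restrict_mem measurableSet_Ioo] with x h1 h2 h3 hx
  rw [h1, Pi.sub_apply, expLp, expLp, h2, h3]
  have e1 : Complex.exp (Complex.I * (m + δ) * x) - Complex.exp (Complex.I * m * x) =
      Complex.exp (Complex.I * m * x) * (Complex.exp (Complex.I * δ * x) - 1) := by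
    rw [mul_sub, ← Complex.exp_add]; ring_nf
  have hx' : |x| ≤ b := abs_le.2 ⟨by linarith [hx.1], hx.2.le⟩
  have e2 : ‖Complex.I * δ * x‖ ≤ ‖δ‖ * b := by
    rw [norm_mul, norm_mul, Complex.norm_I, one_mul, Complex.norm_real]
    exact mul_le_mul_of_nonneg_left hx' (norm_nonneg _)
  have e3 : ‖Complex.exp (Complex.I * m * x)‖ = 1 := by
    rw [Complex.norm_exp]; simp
  rw [e1, norm_mul, e3, one_mul]
  calc _ ≤ Real.exp ‖Complex.I * δ * x‖ * ‖Complex.I * δ * x‖ := norm_exp_sub_one_le_mul_exp _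
    _ ≤ Real.exp (K * b) * (‖δ‖ * b) := by
      gcongr
      exact e2.trans (by gcongr)
    _ = _ := by ring

/-- Square summable perturbations of the frequencies of a Riesz basis of exponentials are
interpolating. -/
theorem isInterpolating_of_isRieszBasis {a : ℝ} (ha : a < Real.pi) {n : ℤ → ℤ}
    (hn : Function.Injective n) (hR : IsRieszBasis (expSystem a n)) {κ : ℤ → ℂ}
    (hκ : Memℓp κ 2) : IsInterpolating a sinPi fun k => n k + κ k := by
  obtain ⟨K, hK⟩ := exists_bound_of_memℓp hκ
  obtain ⟨C, hC⟩ := exists_norm_expLp_sub_le ha K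
  have hsum : Summable fun k => ‖expLp a (n k + κ k) - expSystem a n k‖ ^ 2 := by
    refine Summable.of_nonneg_of_le (fun k => by positivity) (fun k => ?_)
      ((memℓp_two_iff.1 hκ).mul_left (C ^ 2))
    rw [← mul_pow]
    exact pow_le_pow_left₀ (norm_nonneg _) (hC _ _ (hK k)) 2
  have hsmall : ∀ᶠ k in cofinite, ‖κ k‖ < 1 / 2 := by
    have := (memℓp_two_iff.1 hκ).tendsto_cofinite_zero.eventually
      (gt_mem_nhds (show (0 : ℝ) < (1 / 2) ^ 2 by norm_num))
    filter_upwards [this] with k hk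
    exact lt_of_pow_lt_pow_left₀ 2 (by norm_num) hk
  -- `S` is large enough both for the Riesz basis property after resetting the nodes in `S` and to
  -- contain every `k` with `‖κ k‖ ≥ 1/2`.
  obtain ⟨S, hSR, hS⟩ := ((hR.eventually_perturbation hsum).and
    (eventually_ge_atTop (show {k | ¬ ‖κ k‖ < 1 / 2}.Finite from hsmall).toFinset)).exists
  set κ' : ℤ → ℂ := fun k => if k ∈ S then 0 else κ k with hκ'
  have hκs : ∀ k, ‖κ' k‖ < 1 / 2 := fun k => by
    by_cases hk : k ∈ S
    · simp [hκ', hk]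
    · simp only [hκ', hk, if_false]
      by_contra hcon
      exact hk (hS (by simpa using hcon))
  have hκ'2 : Memℓp κ' 2 := Memℓp.of_norm_le_mul hκ 1 fun k => by
    by_cases hk : k ∈ S <;> simp [hκ', hk]
  have hR' : IsRieszBasis fun k => expLp a (n k + κ' k) := by
    convert hSR using 2 with k
    by_cases hk : k ∈ S <;> simp [hκ', hk, expSystem_eq]
  -- Perturbations below `1/2` of distinct integers stay distinct, so multiplicities play no role
  -- until the nodes in `S` are restored.
  have hinj : Function.Injective fun k => (n k : ℂ) + κ' k := fun k l hkl => by
    refine hn ?_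
    have h1 : ((n k - n l : ℤ) : ℂ) = κ' l - κ' k := by
      push_cast
      have h0 : (n k : ℂ) + κ' k = n l + κ' l := hkl
      linear_combination h0
    have h2 : ‖((n k - n l : ℤ) : ℂ)‖ < 1 := by
      rw [h1]
      linarith [norm_sub_le (κ' l) (κ' k), hκs k, hκs l]
    rw [Complex.norm_intCast] at h2
    have h3 : |n k - n l| < 1 := by exact_mod_cast h2
    rw [Int.abs_lt_one_iff] at h3
    omega
  refine IsInterpolating.congr_finite ha differentiable_sinPi S
    (ν := fun k => (n k : ℂ) + κ' k) ?_ fun k hk => by simp [hκ', hk]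
  refine ⟨fun F hF hV => ?_, fun i => ?_, ?_⟩
  · obtain ⟨f, hf⟩ := hF.exists_inner_eq
    have : f = 0 := hR'.eq_zero_of_inner_eq_zero fun k => by
      rw [← hf]; exact hV.apply_eq_zero (mem_univ k)
    funext z
    rw [hf, this, inner_zero_left, Pi.zero_apply]
  · obtain ⟨f, hf⟩ := hR'.exists_inner_eq (d := Pi.single i 1) (by
      rw [memℓp_two_iff]
      refine summable_of_ne_finset_zero (s := {i}) fun k hk => ?_
      simp [show k ≠ i by simpa using hk])
    refine ⟨_, isPaleyWiener_inner f, fun h0 => ?_, vanishesOn_of_injOn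
      (isPaleyWiener_inner f).differentiable hinj.injOn fun k hk => ?_⟩
    · have := congrFun h0 (n i + κ' i)
      simp [hf] at this
    · simp only [hf]
      simp [show k ≠ i by simpa using hk]
  -- Up to sign `sin π(n + κ')` is `sin πκ'`, which is of order `κ'`.
  · have hd : Memℓp (fun k => -sinPi (n k + κ' k)) 2 := by
      refine Memℓp.of_norm_le_mul hκ'2 (Real.exp (Real.pi * (1 / 2)) * Real.pi) fun k => ?_
      rw [norm_neg, norm_sinPi_int_add, mul_assoc]
      have e : ‖(Real.pi : ℂ) * κ' k‖ = Real.pi * ‖κ' k‖ := by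
        rw [norm_mul, Complex.norm_real, Real.norm_of_nonneg Real.pi_pos.le]
      refine (norm_sin_le_mul_exp _).trans ?_
      rw [e]
      have := (hκs k).le
      have := Real.pi_pos
      gcongr
    obtain ⟨f, hf⟩ := hR'.exists_inner_eq hd
    refine ⟨_, isPaleyWiener_inner f, vanishesOn_of_injOn
      (differentiable_sinPi.add (isPaleyWiener_inner f).differentiable) hinj.injOn fun k _ => ?_⟩
    simp [hf]

/-! ### Counting zeros of entire functions in a disc -/

/-- `Z` is the multiset of zeros of `f` in the open disc of radius `r` around `c`. -/
structure IsZeroMultiset (f : ℂ → ℂ) (c : ℂ) (r : ℝ) (Z : Multiset ℂ) : Prop where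
  mem_ball : ∀ z ∈ Z, z ∈ Metric.ball c r
  count_eq : ∀ z ∈ Metric.ball c r, (Z.count z : ℕ∞) = analyticOrderAt f z

theorem IsZeroMultiset.ext {f : ℂ → ℂ} {c : ℂ} {r : ℝ} {Z Z' : Multiset ℂ}
    (h : IsZeroMultiset f c r Z) (h' : IsZeroMultiset f c r Z') : Z = Z' := by
  refine Multiset.ext.2 fun z => ?_
  by_cases hz : z ∈ Metric.ball c r
  · have := (h.count_eq z hz).trans (h'.count_eq z hz).symm
    exact_mod_cast this
  · rw [Multiset.count_eq_zero.2 fun h1 => hz (h.mem_ball z h1),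
      Multiset.count_eq_zero.2 fun h1 => hz (h'.mem_ball z h1)]

theorem exists_entire_eq_sub_mul {f : ℂ → ℂ} (hf : Differentiable ℂ f) {w : ℂ} (hw : f w = 0) :
    ∃ g : ℂ → ℂ, Differentiable ℂ g ∧ f = fun z => (z - w) * g z := by
  refine ⟨dslope f w, ?_, funext fun z => ?_⟩
  · rw [← differentiableOn_univ, Complex.differentiableOn_dslope univ_mem]
    exact hf.differentiableOn
  · have := sub_smul_dslope f w z
    rw [hw, sub_zero, smul_eq_mul] at this
    exact this.symm

theorem exists_entire_eq_pow_mul {f : ℂ → ℂ} (hf : Differentiable ℂ f) (h0 : f ≠ 0) (w : ℂ) :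
    ∃ (n : ℕ) (g : ℂ → ℂ), Differentiable ℂ g ∧ g w ≠ 0 ∧ f = fun z => (z - w) ^ n * g z := by
  have htop : analyticOrderAt f w ≠ ⊤ := fun h =>
    h0 ((AnalyticOnNhd.analyticOrderAt_eq_top_iff_eq_zero w fun z => hf.analyticAt z).1 h)
  obtain ⟨n, hn⟩ := ENat.ne_top_iff_exists.1 htop
  clear htop
  induction n generalizing f with
  | zero =>
    refine ⟨0, f, hf, ?_, by simp⟩
    exact (hf.analyticAt w).analyticOrderAt_eq_zero.1 (by simpa using hn.symm)
  | succ n ih =>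
    have hfw : f w = 0 := apply_eq_zero_of_analyticOrderAt_ne_zero (by
      rw [← hn]
      exact_mod_cast n.succ_ne_zero)
    obtain ⟨g, hg, rfl⟩ := exists_entire_eq_sub_mul hf hfw
    rw [analyticOrderAt_sub_mul hg, if_pos rfl, Nat.cast_add, Nat.cast_one, add_comm] at hn
    have hn' := le_antisymm ((ENat.add_le_add_iff_left (by simp : (1 : ℕ∞) ≠ ⊤)).1 hn.le)
      ((ENat.add_le_add_iff_left (by simp : (1 : ℕ∞) ≠ ⊤)).1 hn.ge)
    obtain ⟨m, k, hk, hkw, rfl⟩ := ih hg (fun h => h0 (by rw [h]; funext z; simp)) hn'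
    exact ⟨m + 1, k, hk, hkw, funext fun z => by ring⟩

theorem exists_entire_eq_prod_mul (A : Finset ℂ) {f : ℂ → ℂ} (hf : Differentiable ℂ f)
    (h0 : f ≠ 0) : ∃ (Z : Multiset ℂ) (g : ℂ → ℂ), (∀ z ∈ Z, z ∈ A) ∧ Differentiable ℂ g ∧
      (∀ z ∈ A, g z ≠ 0) ∧ f = fun z => (Z.map fun w => z - w).prod * g z := by
  classical
  induction A using Finset.induction_on with
  | empty => exact ⟨0, f, by simp, hf, by simp, by simp⟩
  | insert w A hw ih =>
    obtain ⟨Z, g, hZ, hg, hgA, rfl⟩ := ih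
    obtain ⟨n, h, hh, hhw, rfl⟩ := exists_entire_eq_pow_mul hg
      (fun hg0 => h0 (by rw [hg0]; funext z; simp)) w
    refine ⟨Z + Multiset.replicate n w, h, fun z hz => ?_, hh, fun z hz => ?_, funext fun z => ?_⟩
    · rcases Multiset.mem_add.1 hz with hz | hz
      · exact Finset.mem_insert_of_mem (hZ z hz)
      · rw [Multiset.eq_of_mem_replicate hz]
        exact Finset.mem_insert_self _ _
    · rcases Finset.mem_insert.1 hz with rfl | hz
      · exact hhw
      · exact right_ne_zero_of_mul (hgA z hz)
    · simp [mul_assoc]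

theorem analyticOrderAt_prod_mul (Z : Multiset ℂ) {g : ℂ → ℂ} (hg : Differentiable ℂ g) (w : ℂ) :
    Differentiable ℂ (fun z => (Z.map fun w => z - w).prod * g z) ∧
      analyticOrderAt (fun z => (Z.map fun w => z - w).prod * g z) w =
        Z.count w + analyticOrderAt g w := by
  classical
  induction Z using Multiset.induction_on with
  | empty => simpa using hg
  | cons v Z ih =>
    have : (fun z => ((v ::ₘ Z).map fun w => z - w).prod * g z) =
        fun z => (z - v) * ((Z.map fun w => z - w).prod * g z) := by
      funext z
      simp [mul_assoc]
    rw [this]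
    refine ⟨(differentiable_id.sub_const v).mul ih.1, ?_⟩
    rw [analyticOrderAt_sub_mul ih.1, ih.2, Multiset.count_cons]
    by_cases hvw : v = w
    · subst hvw
      simp [add_assoc, add_comm]
    · simp [hvw, Ne.symm hvw]

/-- Logarithmic derivatives add: each factor `z - w` contributes `2πi`, and the zero-free factor `g`
contributes nothing by Cauchy's theorem. -/
theorem circleIntegral_logDeriv_prod_mul {c : ℂ} {r : ℝ} (hr : 0 ≤ r) (Z : Multiset ℂ)
    (hZ : ∀ z ∈ Z, z ∈ Metric.ball c r) {g : ℂ → ℂ} (hg : Differentiable ℂ g)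
    (hg0 : ∀ z ∈ Metric.closedBall c r, g z ≠ 0) :
    (∀ z ∈ Metric.sphere c r, (Z.map fun w => z - w).prod * g z ≠ 0) ∧
    (∮ z in C(c, r), logDeriv (fun z => (Z.map fun w => z - w).prod * g z) z) =
      2 * Real.pi * Complex.I * Z.card := by
  induction Z using Multiset.induction_on with
  | empty =>
    simp only [Multiset.map_zero, Multiset.prod_zero, one_mul, Multiset.card_zero, Nat.cast_zero,
      mul_zero]
    refine ⟨fun z hz => hg0 z (Metric.sphere_subset_closedBall hz), ?_⟩
    refine Complex.circleIntegral_eq_zero_of_differentiable_on_off_countable hr countable_empty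
      ?_ ?_
    · exact (hg.deriv.continuous.continuousOn).div hg.continuous.continuousOn hg0
    · exact fun z hz => (hg.deriv z).div (hg z) (hg0 z (Metric.ball_subset_closedBall hz.1))
  | cons v Z ih =>
    obtain ⟨h0, hI⟩ := ih fun z hz => hZ z (Multiset.mem_cons_of_mem hz)
    have hv := hZ v (Multiset.mem_cons_self v Z)
    have hd := (analyticOrderAt_prod_mul Z hg 0).1
    have hvs : ∀ z ∈ Metric.sphere c r, z - v ≠ 0 := fun z hz hzv => by
      rw [sub_eq_zero] at hzv
      rw [hzv, Metric.mem_sphere] at hz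
      exact absurd hz (Metric.mem_ball.1 hv).ne
    have he : (fun z => ((v ::ₘ Z).map fun w => z - w).prod * g z) =
        fun z => (z - v) * ((Z.map fun w => z - w).prod * g z) := by
      funext z
      simp [mul_assoc]
    rw [he]
    refine ⟨fun z hz => ?_, ?_⟩
    · have := congrFun he z
      rw [this]
      exact mul_ne_zero (hvs z hz) (h0 z hz)
    · have hcong : EqOn (logDeriv fun z => (z - v) * ((Z.map fun w => z - w).prod * g z))
          (fun z => (z - v)⁻¹ + logDeriv (fun z => (Z.map fun w => z - w).prod * g z) z)
          (Metric.sphere c r) := fun z hz => by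
        rw [logDeriv_mul z (hvs z hz) (h0 z hz) (by fun_prop) (hd z)]
        congr 1
        rw [logDeriv_apply, deriv_sub_const, deriv_id'', one_div]
      rw [circleIntegral.integral_congr hr hcong, circleIntegral.integral_add, hI,
        circleIntegral.integral_sub_inv_of_mem_ball hv]
      · simp; ring
      · exact ContinuousOn.circleIntegrable hr
          (((continuous_id.sub continuous_const).continuousOn).inv₀ hvs)
      · exact ContinuousOn.circleIntegrable hr
          ((hd.deriv.continuous.continuousOn).div hd.continuous.continuousOn h0)

theorem finite_zeros_closedBall {f : ℂ → ℂ} (hf : Differentiable ℂ f) (h0 : f ≠ 0) (c : ℂ) (r : ℝ) :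
    {z | z ∈ Metric.closedBall c r ∧ f z = 0}.Finite := by
  by_contra hinf
  obtain ⟨x, -, hx⟩ := Set.Infinite.exists_accPt_of_subset_isCompact hinf
    (isCompact_closedBall c r) fun z hz => hz.1
  rw [accPt_iff_frequently_nhdsNE] at hx
  have := AnalyticOnNhd.eqOn_zero_of_preconnected_of_frequently_eq_zero (U := univ)
    (fun z _ => hf.analyticAt z) isPreconnected_univ (mem_univ x) (hx.mono fun z hz => hz.2)
  exact h0 ((eqOn_univ _ _).1 this)

/-- The argument principle. -/
theorem exists_isZeroMultiset {f : ℂ → ℂ} (hf : Differentiable ℂ f) {c : ℂ} {r : ℝ} (hr : 0 ≤ r)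
    (hs : ∀ z ∈ Metric.sphere c r, f z ≠ 0) : ∃ Z, IsZeroMultiset f c r Z ∧
      (∮ z in C(c, r), logDeriv f z) = 2 * Real.pi * Complex.I * Multiset.card Z := by
  have hmem : c + r ∈ Metric.sphere c r := by simp [abs_of_nonneg hr]
  have h0 : f ≠ 0 := fun h => hs _ hmem (by rw [h]; rfl)
  obtain ⟨Z, g, hZ, hg, hgA, rfl⟩ :=
    exists_entire_eq_prod_mul (finite_zeros_closedBall hf h0 c r).toFinset hf h0
  simp only [Finite.mem_toFinset, mem_ofPred_eq] at hZ hgA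
  have hZb : ∀ z ∈ Z, z ∈ Metric.ball c r := fun z hz => by
    rcases lt_or_eq_of_le (Metric.mem_closedBall.1 (hZ z hz).1) with h | h
    · exact h
    · exact absurd (hZ z hz).2 (hs z h)
  have hg0 : ∀ z ∈ Metric.closedBall c r, g z ≠ 0 := fun z hz hgz =>
    hgA z ⟨hz, by rw [hgz, mul_zero]⟩ hgz
  refine ⟨Z, ⟨hZb, fun z hz => ?_⟩, (circleIntegral_logDeriv_prod_mul hr Z hZb hg hg0).2⟩
  rw [(analyticOrderAt_prod_mul Z hg z).2,
    (hg.analyticAt z).analyticOrderAt_eq_zero.2 (hg0 z (Metric.ball_subset_closedBall hz)),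
    add_zero]

/-- Rouché's theorem for discs. -/
theorem IsZeroMultiset.exists_card_eq {f s : ℂ → ℂ} (hf : Differentiable ℂ f)
    (hs : Differentiable ℂ s) {c : ℂ} {r : ℝ} (hr : 0 ≤ r) {Z : Multiset ℂ}
    (hZ : IsZeroMultiset s c r Z) (hlt : ∀ z ∈ Metric.sphere c r, ‖f z - s z‖ < ‖s z‖) :
    ∃ Z', IsZeroMultiset f c r Z' ∧ Multiset.card Z' = Multiset.card Z := by
  have hs0 : ∀ z ∈ Metric.sphere c r, s z ≠ 0 := fun z hz h => by
    have := hlt z hz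
    rw [h, norm_zero] at this
    exact absurd this (norm_nonneg _).not_gt
  have hf0 : ∀ z ∈ Metric.sphere c r, f z ≠ 0 := fun z hz h => by
    have := hlt z hz
    rw [h, zero_sub, norm_neg] at this
    exact lt_irrefl _ this
  obtain ⟨Z₁, h1, hI1⟩ := exists_isZeroMultiset hs hr hs0
  obtain ⟨Z₂, h2, hI2⟩ := exists_isZeroMultiset hf hr hf0
  rw [hZ.ext h1]
  refine ⟨Z₂, h2, ?_⟩
  have hint : ∀ {k : ℂ → ℂ}, Differentiable ℂ k → (∀ z ∈ Metric.sphere c r, k z ≠ 0) →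
      CircleIntegrable (logDeriv k) c r := fun hk hk0 => ContinuousOn.circleIntegrable hr
    ((hk.deriv.continuous.continuousOn).div hk.continuous.continuousOn hk0)
  -- On the circle `f / s` stays in the unit disc around `1`, so its principal logarithm is a
  -- primitive of the difference of logarithmic derivatives.
  have hzero : (∮ z in C(c, r), (logDeriv f z - logDeriv s z)) = 0 := by
    refine circleIntegral.integral_eq_zero_of_hasDerivWithinAt hr
      (f := fun z => Complex.log (f z / s z)) fun z hz => ?_
    have hsl : f z / s z ∈ Complex.slitPlane := by
      have : f z / s z = 1 + (f z - s z) / s z := by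
        field_simp [hs0 z hz]
        ring
      rw [this]
      refine Complex.mem_slitPlane_of_norm_lt_one ?_
      rw [norm_div, div_lt_one (norm_pos_iff.2 (hs0 z hz))]
      exact hlt z hz
    have hd := ((hf z).hasDerivAt.fun_div (hs z).hasDerivAt (hs0 z hz)).clog hsl
    refine (hd.congr_deriv ?_).hasDerivWithinAt
    have := hs0 z hz
    have := hf0 z hz
    rw [logDeriv_apply, logDeriv_apply]
    field_simp
  rw [circleIntegral.integral_sub (hint hf hf0) (hint hs hs0), hI1, hI2, sub_eq_zero] at hzero
  exact_mod_cast mul_left_cancel₀ Complex.two_pi_I_ne_zero hzero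

/-! ### Zeros of perturbations of the sine -/

theorem norm_sinPi_sq (z : ℂ) :
    ‖sinPi z‖ ^ 2 = Real.sin (Real.pi * z.re) ^ 2 + Real.sinh (Real.pi * z.im) ^ 2 := by
  have hre : (Real.pi * z : ℂ).re = Real.pi * z.re := by simp
  have him : (Real.pi * z : ℂ).im = Real.pi * z.im := by simp
  rw [sinPi, Complex.sin_eq, hre, him, ← Complex.normSq_eq_norm_sq]
  have : Complex.sin ↑(Real.pi * z.re) * Complex.cosh ↑(Real.pi * z.im) +
      Complex.cos ↑(Real.pi * z.re) * Complex.sinh ↑(Real.pi * z.im) * Complex.I =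
      ((Real.sin (Real.pi * z.re) * Real.cosh (Real.pi * z.im) : ℝ) : ℂ) +
        ((Real.cos (Real.pi * z.re) * Real.sinh (Real.pi * z.im) : ℝ) : ℂ) * Complex.I := by
    push_cast; rfl
  rw [this, Complex.normSq_add_mul_I]
  have h1 := Real.cosh_sq (Real.pi * z.im)
  have h2 := Real.sin_sq_add_cos_sq (Real.pi * z.re)
  linear_combination (Real.sin (Real.pi * z.re) ^ 2) * h1 +
    (Real.sinh (Real.pi * z.im) ^ 2) * h2

theorem abs_le_abs_sinh (t : ℝ) : |t| ≤ |Real.sinh t| := by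
  rw [Real.abs_sinh]
  exact Real.self_le_sinh_iff.2 (abs_nonneg t)

theorem two_mul_abs_le_abs_sin {t : ℝ} (ht : |t| ≤ 1 / 2) : 2 * |t| ≤ |Real.sin (Real.pi * t)| := by
  have hpi := Real.pi_pos
  have key : ∀ t : ℝ, 0 ≤ t → t ≤ 1 / 2 → 2 * t ≤ Real.sin (Real.pi * t) := fun t h0 h1 => by
    have := Real.mul_le_sin (x := Real.pi * t) (by positivity) (by nlinarith)
    convert this using 1
    field_simp
  rcases le_total 0 t with h | h
  · rw [abs_of_nonneg h] at *
    exact (key t h ht).trans (le_abs_self _)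
  · rw [abs_of_nonpos h] at *
    have := key (-t) (by linarith) ht
    rw [mul_neg Real.pi, Real.sin_neg] at this
    linarith [neg_le_abs (Real.sin (Real.pi * t))]

/-- Jordan's inequality handles the real direction, `|sinh t| ≥ |t|` and `π ≥ 2` the imaginary one.
-/
theorem two_mul_norm_le_norm_sinPi {u : ℂ} (hre : |u.re| ≤ 1 / 2) : 2 * ‖u‖ ≤ ‖sinPi u‖ := by
  refine le_of_sq_le_sq ?_ (norm_nonneg _)
  rw [norm_sinPi_sq, mul_pow, ← Complex.normSq_eq_norm_sq, Complex.normSq_apply]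
  have h2 := two_mul_abs_le_abs_sin hre
  have h3 := abs_le_abs_sinh (Real.pi * u.im)
  rw [abs_mul, abs_of_pos Real.pi_pos] at h3
  have h2' := pow_le_pow_left₀ (by positivity) h2 2
  have h3' := pow_le_pow_left₀ (by positivity) h3 2
  rw [mul_pow, sq_abs, sq_abs] at h2' h3'
  have h4 : (2 : ℝ) ^ 2 ≤ Real.pi ^ 2 := by gcongr; exact Real.two_le_pi
  have h5 := mul_le_mul_of_nonneg_right h4 (sq_nonneg u.im)
  nlinarith

theorem two_mul_norm_sub_int_le {z : ℂ} {m : ℤ} (h : |z.re - m| ≤ 1 / 2) :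
    2 * ‖z - m‖ ≤ ‖sinPi z‖ := by
  have h1 := two_mul_norm_le_norm_sinPi (u := z - m) (by simpa using h)
  rwa [← norm_sinPi_int_add m, add_sub_cancel] at h1

theorem two_mul_norm_sub_round_le (z : ℂ) : 2 * ‖z - (round z.re : ℤ)‖ ≤ ‖sinPi z‖ :=
  two_mul_norm_sub_int_le (abs_sub_round z.re)

theorem sinPi_eq_zero_iff {z : ℂ} : sinPi z = 0 ↔ ∃ m : ℤ, z = m := by
  constructor
  · intro h
    have := two_mul_norm_sub_round_le z
    rw [h, norm_zero] at this
    have h0 : ‖z - (round z.re : ℤ)‖ = 0 := le_antisymm (by linarith) (norm_nonneg _)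
    exact ⟨_, sub_eq_zero.1 (norm_eq_zero.1 h0)⟩
  · rintro ⟨m, rfl⟩
    have := sinPi_int_add m 0
    rw [add_zero] at this
    rw [this]
    simp [sinPi]

theorem analyticOrderAt_sinPi_int (m : ℤ) : analyticOrderAt sinPi m = 1 := by
  refine (differentiable_sinPi.analyticAt _).analyticOrderAt_eq_one_of_zero_deriv_ne_zero
    (sinPi_eq_zero_iff.2 ⟨m, rfl⟩) ?_
  have h : HasDerivAt sinPi (Complex.cos (Real.pi * m) * (Real.pi * 1)) m :=
    ((hasDerivAt_id (m : ℂ)).const_mul (Real.pi : ℂ)).csin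
  rw [h.deriv, mul_one]
  refine mul_ne_zero (fun hc => ?_) (by exact_mod_cast Real.pi_ne_zero)
  have h1 := Complex.sin_sq_add_cos_sq (Real.pi * m)
  have h2 : Complex.sin (Real.pi * m) = 0 := sinPi_eq_zero_iff.2 ⟨m, rfl⟩
  rw [hc, h2] at h1
  norm_num at h1

theorem isZeroMultiset_sinPi {c : ℂ} {r : ℝ} (A : Finset ℤ)
    (hA : ∀ m : ℤ, m ∈ A ↔ (m : ℂ) ∈ Metric.ball c r) :
    IsZeroMultiset sinPi c r (A.val.map fun m : ℤ => (m : ℂ)) := by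
  classical
  refine ⟨fun z hz => ?_, fun z hz => ?_⟩
  · obtain ⟨m, hm, rfl⟩ := Multiset.mem_map.1 hz
    exact (hA m).1 hm
  · by_cases h : ∃ m : ℤ, z = m
    · obtain ⟨m, rfl⟩ := h
      rw [analyticOrderAt_sinPi_int, Multiset.count_map_eq_count' _ _ Int.cast_injective,
        Multiset.count_eq_one_of_mem A.nodup ((hA m).2 hz), Nat.cast_one]
    · rw [(differentiable_sinPi.analyticAt z).analyticOrderAt_eq_zero.2
        (mt sinPi_eq_zero_iff.1 h), Multiset.count_eq_zero.2, Nat.cast_zero]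
      intro hm
      obtain ⟨m, -, rfl⟩ := Multiset.mem_map.1 hm
      exact h ⟨m, rfl⟩

theorem exp_div_four_le_norm_sinPi {z : ℂ} (hz : 1 ≤ Real.pi * |z.im|) :
    Real.exp (Real.pi * |z.im|) / 4 ≤ ‖sinPi z‖ := by
  have h1 : Real.sinh (Real.pi * |z.im|) ≤ ‖sinPi z‖ := by
    have h2 := norm_sinPi_sq z
    have h3 : Real.sinh (Real.pi * |z.im|) = |Real.sinh (Real.pi * z.im)| := by
      rw [Real.abs_sinh, abs_mul, abs_of_pos Real.pi_pos]
    rw [h3]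
    refine abs_le_of_sq_le_sq ?_ (norm_nonneg (sinPi z))
    nlinarith [sq_nonneg (Real.sin (Real.pi * z.re))]
  refine le_trans ?_ h1
  rw [Real.sinh_eq]
  have h4 : (2 : ℝ) ≤ Real.exp (Real.pi * |z.im|) := by
    have := Real.add_one_le_exp (Real.pi * |z.im|)
    linarith
  have h5 : Real.exp (-(Real.pi * |z.im|)) ≤ 1 := Real.exp_le_one_iff.2 (by linarith)
  linarith

/-- Away from the integers, `sin (π z)` eventually dominates exponential transforms. -/
theorem exists_norm_expTransform_lt_norm_sinPi {a : ℝ} (ha : 0 < a) {f : ℝ → ℂ}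
    (hf : Integrable f (symMeasure a)) : ∃ R : ℝ, ∀ z : ℂ, R ≤ ‖z‖ →
      (∀ m : ℤ, 1 / 8 ≤ ‖z - m‖) → ‖expTransform a f z‖ < ‖sinPi z‖ := by
  set C := ∫ x, ‖f x‖ ∂symMeasure a with hC
  have hC0 : 0 ≤ C := integral_nonneg fun _ => norm_nonneg _
  -- For `|Im z| > Y` the sine is at least `exp (π|Im z|) / 4` and the transform at most `C exp ((π
  -- - a)|Im z|)`; the surplus `exp (a|Im z|)` exceeds `4C`. The summand `1` secures `π|Im z| ≥ 1`.
  set Y := 4 * C / a + 1 with hY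
  -- In the strip, distance `1/8` from the integers forces `|sin πz| ≥ 2 · 1/8`, whence the bound
  -- `1/4`.
  obtain ⟨R, hR⟩ := exists_norm_expTransform_lt hf Y (show (0 : ℝ) < 1 / 4 by norm_num)
  refine ⟨R + Y, fun z hz hm => ?_⟩
  rcases le_or_gt |z.im| Y with hzY | hzY
  · have h1 := Complex.norm_le_abs_re_add_abs_im z
    have h2 := hR z hzY (by linarith)
    have h3 := two_mul_norm_sub_round_le z
    have h4 := hm (round z.re)
    linarith
  · have hpi := Real.pi_gt_three
    have hYp : 1 ≤ Y := by
      have : 0 ≤ 4 * C / a := by positivity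
      linarith
    have h1 := exp_div_four_le_norm_sinPi (z := z) (by nlinarith)
    have h2 := norm_expTransform_le hf (le_refl |z.im|)
    have h3 : Real.exp (Real.pi * |z.im|) =
        Real.exp (|z.im| * (Real.pi - a)) * Real.exp (a * |z.im|) := by
      rw [← Real.exp_add]; ring_nf
    have h4 : 4 * C < Real.exp (a * |z.im|) := by
      have h5 := Real.add_one_le_exp (a * |z.im|)
      have h6 : 4 * C / a < |z.im| := by linarith
      rw [div_lt_iff₀ ha] at h6
      linarith
    have h7 := Real.exp_pos (|z.im| * (Real.pi - a))
    rw [h3] at h1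
    nlinarith

/-! ### Asymptotics and numbering of the zeros -/

/-- The interval lies in `(-π, π)`, so these values are, up to a factor and the sign of `m`, the
Fourier coefficients of the extension by zero. -/
theorem memℓp_expTransform_int {a : ℝ} (ha : 0 < a) (ha' : a < Real.pi) {f : ℝ → ℂ}
    (hf : MemLp f 2 (symMeasure a)) : Memℓp (fun m : ℤ => expTransform a f m) 2 := by
  set I := Ioo (a - Real.pi) (Real.pi - a) with hI
  have hlt : -Real.pi < Real.pi := by linarith [Real.pi_pos]
  have hsub : I ⊆ Ioc (-Real.pi) Real.pi := fun x hx => ⟨by linarith [hx.1], by linarith [hx.2]⟩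
  have hL : MemLp (I.indicator f) 2 (volume.restrict (Ioc (-Real.pi) Real.pi)) := by
    rw [memLp_indicator_iff_restrict measurableSet_Ioo, Measure.restrict_restrict measurableSet_Ioo,
      inter_eq_left.2 hsub]
    exact hf
  have h := (hasSum_sq_fourierCoeffOn hlt hL).summable
  rw [memℓp_two_iff, ← (Equiv.neg ℤ).summable_iff]
  refine (h.mul_left ((2 * Real.pi) ^ 2)).congr fun m => ?_
  rw [← mul_pow, Function.comp_apply]
  congr 1
  have key : expTransform a f (Equiv.neg ℤ m : ℤ) =
      (2 * Real.pi : ℝ) • fourierCoeffOn hlt (I.indicator f) m := by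
    rw [fourierCoeffOn_eq_integral, smul_smul, expTransform,
      intervalIntegral.integral_of_le hlt.le]
    have e1 : 2 * Real.pi * (1 / (Real.pi - -Real.pi)) = 1 := by
      have := Real.pi_ne_zero
      field_simp
      ring
    have e2 : ∀ x : ℝ, fourier (-m) (x : AddCircle (Real.pi - -Real.pi)) • I.indicator f x =
        I.indicator (fun x => f x * Complex.exp (Complex.I * (Equiv.neg ℤ m : ℤ) * x)) x := by
      intro x
      by_cases hx : x ∈ I
      · rw [indicator_of_mem hx, indicator_of_mem hx, fourier_coe_apply, smul_eq_mul, mul_comm]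
        congr 2
        have : (Real.pi : ℂ) ≠ 0 := by exact_mod_cast Real.pi_ne_zero
        push_cast
        simp only [Equiv.neg_apply, Int.cast_neg]
        rw [sub_neg_eq_add, ← two_mul]
        field_simp
      · rw [indicator_of_notMem hx, indicator_of_notMem hx, smul_zero]
    simp only [e2]
    rw [e1, one_smul, setIntegral_indicator measurableSet_Ioo, inter_eq_right.2 hsub]
  rw [key, norm_smul, Real.norm_of_nonneg (by positivity)]

theorem one_le_norm_intCast_sub {k m : ℤ} (h : k ≠ m) : 1 ≤ ‖(k : ℂ) - m‖ := by
  rw [← Int.cast_sub, Complex.norm_intCast]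
  exact_mod_cast Int.one_le_abs (sub_ne_zero.2 h)

/-- Localisation of the zeros of `sin (π z) + F(z)`. -/
theorem exists_zeros_localization {a : ℝ} (ha : 0 < a) {f : ℝ → ℂ}
    (hf : Integrable f (symMeasure a)) : ∃ N₀ : ℕ, ∀ N : ℕ, N₀ ≤ N →
      (∀ m : ℤ, (N : ℤ) < |m| → ∃ ζ ∈ Metric.ball (m : ℂ) (1 / 8),
        analyticOrderAt (sinPi + expTransform a f) ζ = 1 ∧ ‖ζ - m‖ ≤ ‖expTransform a f m‖ ∧
        ∀ z ∈ Metric.ball (m : ℂ) (1 / 8), (sinPi + expTransform a f) z = 0 → z = ζ) ∧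
      (∀ z, (sinPi + expTransform a f) z = 0 → z ∈ Metric.ball 0 (N + 1 / 2 : ℝ) ∨
        ∃ m : ℤ, (N : ℤ) < |m| ∧ z ∈ Metric.ball (m : ℂ) (1 / 8)) ∧
      ∃ Z : Multiset ℂ, IsZeroMultiset (sinPi + expTransform a f) 0 (N + 1 / 2 : ℝ) Z ∧
        Multiset.card Z = 2 * N + 1 := by
  have hFd := differentiable_expTransform hf
  have hd : Differentiable ℂ (sinPi + expTransform a f) := differentiable_sinPi.add hFd
  obtain ⟨R, hR⟩ := exists_norm_expTransform_lt_norm_sinPi ha hf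
  -- The transform of `i x f` is the derivative of that of `f`; it is below `1` far out in the strip
  -- `|Im z| ≤ 1`.
  obtain ⟨R', hR'⟩ := exists_norm_expTransform_lt (integrable_id_mul hf) 1 one_pos
  refine ⟨⌈max R R'⌉₊, fun N hN => ?_⟩
  have hN' : max R R' ≤ N := (Nat.le_ceil _).trans (by exact_mod_cast hN)
  have hNR : R ≤ N := (le_max_left _ _).trans hN'
  have hNR' : R' ≤ N := (le_max_right _ _).trans hN'
  have hcast : ∀ m : ℤ, (N : ℤ) < |m| → (N : ℝ) + 1 ≤ ‖(m : ℂ)‖ := fun m hm => by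
    rw [Complex.norm_intCast]
    exact_mod_cast hm
  have hdiff : ∀ z, ‖(sinPi + expTransform a f) z - sinPi z‖ = ‖expTransform a f z‖ := fun z => by
    simp
  refine ⟨fun m hm => ?_, fun z hz => ?_, ?_⟩
  · have hmN := hcast m hm
    obtain ⟨Z, hZ, hcard⟩ := (isZeroMultiset_sinPi (c := m) (r := 1 / 8) {m} fun k => by
        rw [Finset.mem_singleton, Metric.mem_ball, dist_eq_norm]
        refine ⟨?_, fun hk => ?_⟩
        · rintro rfl
          simp
        · by_contra hne
          linarith [one_le_norm_intCast_sub hne]).exists_card_eq hd differentiable_sinPi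
      (by norm_num) (fun z hz => by
        rw [Metric.mem_sphere, dist_eq_norm] at hz
        rw [hdiff]
        refine hR z ?_ fun k => ?_
        · have := norm_sub_norm_le (m : ℂ) z
          rw [norm_sub_rev, hz] at this
          linarith
        · by_cases hk : k = m
          · rw [hk, hz]
          · have h1 := one_le_norm_intCast_sub hk
            have h2 := norm_sub_le_norm_sub_add_norm_sub (k : ℂ) z m
            rw [hz, norm_sub_rev (k : ℂ) z] at h2
            linarith)
    rw [Multiset.card_map, Finset.card_val, Finset.card_singleton, Multiset.card_eq_one] at hcard
    obtain ⟨ζ, rfl⟩ := hcard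
    have hζ := hZ.mem_ball ζ (Multiset.mem_singleton_self ζ)
    have hord : analyticOrderAt (sinPi + expTransform a f) ζ = 1 := by
      rw [← hZ.count_eq ζ hζ]
      simp
    refine ⟨ζ, hζ, hord, ?_, fun z hz hz0 => ?_⟩
    · have h0 : (sinPi + expTransform a f) ζ = 0 :=
        apply_eq_zero_of_analyticOrderAt_ne_zero (by rw [hord]; exact one_ne_zero)
      have hζ' := hζ
      rw [Metric.mem_ball, dist_eq_norm] at hζ'
      -- With `F` the transform, `2|ζ - m| ≤ |sin πζ| = |F ζ| ≤ |F m| + |ζ - m|`, the last step by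
      -- `|F'| ≤ 1`.
      have h1 : 2 * ‖ζ - m‖ ≤ ‖sinPi ζ‖ := two_mul_norm_sub_int_le (by
        have := (Complex.abs_re_le_norm (ζ - m)).trans hζ'.le
        rw [Complex.sub_re, Complex.intCast_re] at this
        linarith)
      have h2 : ‖sinPi ζ‖ = ‖expTransform a f ζ‖ := by
        rw [eq_neg_of_add_eq_zero_left (show sinPi ζ + expTransform a f ζ = 0 from h0), norm_neg]
      have h3 := (convex_ball (m : ℂ) (1 / 8)).norm_image_sub_le_of_norm_deriv_le
        (f := expTransform a f) (C := 1) (fun z _ => hFd z) (fun z hz => by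
          rw [(hasDerivAt_expTransform hf z).deriv]
          rw [Metric.mem_ball, dist_eq_norm] at hz
          have him := (Complex.abs_im_le_norm (z - m)).trans hz.le
          have hre := (Complex.abs_re_le_norm (z - m)).trans hz.le
          rw [Complex.sub_im, Complex.intCast_im, sub_zero] at him
          rw [Complex.sub_re, Complex.intCast_re] at hre
          have hm' : ‖(m : ℂ)‖ = |(m : ℝ)| := by
            rw [Complex.norm_intCast]
          have := abs_sub_abs_le_abs_sub (m : ℝ) z.re
          rw [abs_sub_comm] at this
          exact (hR' z (by linarith) (by linarith)).le)
        (Metric.mem_ball_self (by norm_num)) hζ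
      have h4 := norm_sub_norm_le (expTransform a f ζ) (expTransform a f m)
      linarith
    · have h1 := hZ.count_eq z hz
      by_contra hne
      rw [Multiset.count_singleton, if_neg hne] at h1
      exact (hd.analyticAt z).analyticOrderAt_ne_zero.2 hz0 (by exact_mod_cast h1.symm)
  · by_cases hzb : z ∈ Metric.ball (0 : ℂ) (N + 1 / 2 : ℝ)
    · exact Or.inl hzb
    · right
      rw [mem_ball_zero_iff, not_lt] at hzb
      by_contra! hcon
      have hsin : ‖sinPi z‖ = ‖expTransform a f z‖ := by
        rw [eq_neg_of_add_eq_zero_left (show sinPi z + expTransform a f z = 0 from hz), norm_neg]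
      refine (hR z (by linarith) fun m => ?_).ne hsin.symm
      by_contra! hlt
      refine hcon m ?_ (by rwa [Metric.mem_ball, dist_eq_norm])
      have h1 := norm_sub_norm_le z m
      have h2 : (N : ℝ) < ‖(m : ℂ)‖ := by linarith
      rw [Complex.norm_intCast] at h2
      exact_mod_cast h2
  -- The circle of radius `N + 1/2` keeps distance at least `1/2` from all integers and encloses the
  -- `2N + 1` zeros `-N, …, N` of the sine.
  · obtain ⟨Z, hZ, hcard⟩ := (isZeroMultiset_sinPi (c := 0) (r := N + 1 / 2)
      (Finset.Icc (-N : ℤ) N) fun k => by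
        rw [Finset.mem_Icc, mem_ball_zero_iff, ← abs_le, Complex.norm_intCast]
        constructor
        · intro h
          have : |(k : ℝ)| ≤ N := by exact_mod_cast h
          linarith
        · intro h
          have h1 : |(k : ℝ)| < N + 1 := by linarith
          have h2 : |k| < (N : ℤ) + 1 := by exact_mod_cast h1
          omega).exists_card_eq hd differentiable_sinPi (by positivity) (fun z hz => by
        rw [mem_sphere_zero_iff_norm] at hz
        rw [hdiff]
        refine hR z (by linarith) fun m => ?_
        have h1 := abs_norm_sub_norm_le z m
        rw [hz, Complex.norm_intCast] at h1
        refine le_trans ?_ h1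
        rcases le_or_gt |m| (N : ℤ) with h | h
        · have h2 : |(m : ℝ)| ≤ N := by exact_mod_cast h
          rw [abs_of_nonneg (by linarith)]
          linarith
        · have h2 : (N : ℝ) + 1 ≤ |(m : ℝ)| := by exact_mod_cast h
          rw [abs_of_nonpos (by linarith)]
          linarith)
    refine ⟨Z, hZ, hcard.trans ?_⟩
    rw [Multiset.card_map, Finset.card_val, Int.card_Icc]
    omega

theorem exists_map_eq_multiset {α β : Type*} [DecidableEq α] [Inhabited β] (J : Finset α) :
    ∀ W : Multiset β, Multiset.card W = J.card → ∃ g : α → β, J.val.map g = W := by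
  induction J using Finset.induction_on with
  | empty =>
    intro W hW
    exact ⟨fun _ => default, by simpa [eq_comm] using hW⟩
  | insert i J hi ih =>
    intro W hW
    rw [Finset.card_insert_of_notMem hi] at hW
    obtain ⟨w, W', rfl⟩ := Multiset.card_pos_iff_exists_mem.1 (by omega : 0 < Multiset.card W) |>.imp
      fun w hw => Multiset.exists_cons_of_mem hw
    rw [Multiset.card_cons, Nat.add_right_cancel_iff] at hW
    obtain ⟨g, rfl⟩ := ih W' hW
    refine ⟨Function.update g i w, ?_⟩
    rw [Finset.insert_val_of_notMem hi, Multiset.map_cons, Function.update_self]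
    congr 1
    refine Multiset.map_congr rfl fun k hk => ?_
    rw [Function.update_of_ne]
    rintro rfl
    exact hi hk

/-- All zeros of `sin (π z) + F(z)` can be numbered so that prescribed zeros near the integers
`n k` receive the indices `n k`. -/
theorem exists_numbering {a : ℝ} (ha : 0 < a) (ha' : a < Real.pi) {f : ℝ → ℂ}
    (hf : MemLp f 2 (symMeasure a)) {n : ℤ → ℤ} (hn : Function.Injective n) {κ : ℤ → ℂ}
    (hκ : Memℓp κ 2)
    (hV : VanishesOn (sinPi + expTransform a f) (fun k => n k + κ k) univ) :
    ∃ lam : ℤ → ℂ, (∀ z, {m | lam m = z}.encard = analyticOrderAt (sinPi + expTransform a f) z) ∧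
      Memℓp (fun m => lam m - m) 2 ∧ ∀ k, lam (n k) = n k + κ k := by
  classical
  have hfi := integrable_of_memLp hf
  have hd : Differentiable ℂ (sinPi + expTransform a f) :=
    differentiable_sinPi.add (differentiable_expTransform hfi)
  set h := sinPi + expTransform a f with hh
  set μ : ℤ → ℂ := fun k => n k + κ k with hμ
  obtain ⟨N₀, hN₀⟩ := exists_zeros_localization ha hfi
  have hbad : {k | ¬ ‖κ k‖ < 1 / 8}.Finite := by
    have := (memℓp_two_iff.1 hκ).tendsto_cofinite_zero.eventually
      (gt_mem_nhds (show (0 : ℝ) < (1 / 8) ^ 2 by norm_num))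
    refine this.mono fun k hk => ?_
    exact lt_of_pow_lt_pow_left₀ 2 (by norm_num) hk
  -- `M` bounds the indices and the nodes for the finitely many large `κ k`, so all of these fall
  -- into the central block and the central disc.
  obtain ⟨M, hM⟩ := (hbad.image fun k => max |(n k : ℝ)| ‖μ k‖).bddAbove
  set N := max N₀ ⌈M⌉₊ with hN
  have hMN : M ≤ N := (Nat.le_ceil M).trans (by exact_mod_cast le_max_right _ _)
  have hbadN : ∀ k, ¬ ‖κ k‖ < 1 / 8 → |(n k : ℝ)| ≤ N ∧ ‖μ k‖ ≤ N := fun k hk =>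
    max_le_iff.1 ((hM ⟨k, hk, rfl⟩).trans hMN)
  obtain ⟨hout, hloc, Z, hZ, hZcard⟩ := hN₀ N (le_max_left _ _)
  have hκN : ∀ k, (N : ℤ) < |n k| → ‖κ k‖ < 1 / 8 := fun k hk => by
    by_contra hcon
    have : |n k| ≤ (N : ℤ) := by exact_mod_cast (hbadN k hcon).1
    omega
  have hμN : ∀ k, |n k| ≤ (N : ℤ) → μ k ∈ Metric.ball (0 : ℂ) (N + 1 / 2 : ℝ) := fun k hk => by
    rw [mem_ball_zero_iff]
    by_cases hb : ‖κ k‖ < 1 / 8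
    · have h1 : |(n k : ℝ)| ≤ N := by exact_mod_cast hk
      have h2 := norm_add_le (n k : ℂ) (κ k)
      rw [Complex.norm_intCast] at h2
      have h3 : ‖μ k‖ = ‖(n k : ℂ) + κ k‖ := rfl
      linarith
    · linarith [(hbadN k hb).2]
  choose! ζ hζb hζo hζn hζu using hout
  have hζ0 : ∀ m : ℤ, (N : ℤ) < |m| → h (ζ m) = 0 := fun m hm =>
    apply_eq_zero_of_analyticOrderAt_ne_zero (by rw [hζo m hm]; exact one_ne_zero)
  have hζball : ∀ m : ℤ, (N : ℤ) < |m| → ζ m ∉ Metric.ball (0 : ℂ) (N + 1 / 2 : ℝ) :=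
    fun m hm hb => by
    have h1 := hζb m hm
    rw [Metric.mem_ball, dist_eq_norm] at h1
    rw [mem_ball_zero_iff] at hb
    have h2 : (N : ℝ) + 1 ≤ |(m : ℝ)| := by exact_mod_cast hm
    have h3 := norm_sub_norm_le (m : ℂ) (ζ m)
    rw [norm_sub_rev, Complex.norm_intCast] at h3
    linarith
  set A : Finset ℤ := Finset.Icc (-N : ℤ) N with hA
  have hmemA : ∀ m : ℤ, m ∈ A ↔ |m| ≤ (N : ℤ) := fun m => by rw [hA, Finset.mem_Icc, abs_le]
  set T : Finset ℤ := A.preimage n hn.injOn with hT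
  have hmemT : ∀ k, k ∈ T ↔ |n k| ≤ (N : ℤ) := fun k => by rw [hT, Finset.mem_preimage, hmemA]
  -- The nodes of the central block are zeros in the disc, and `hV` bounds their repetitions by the
  -- multiplicities.
  have hle : T.val.map μ ≤ Z := by
    rw [Multiset.le_iff_count]
    intro z
    by_cases hz : z ∈ Metric.ball (0 : ℂ) (N + 1 / 2 : ℝ)
    · have h1 : ((T.val.map μ).count z : ℕ∞) ≤ Z.count z := by
        rw [hZ.count_eq z hz]
        refine le_trans ?_ (hV z)
        rw [Multiset.count_map, ← Finset.filter_val, Finset.card_val,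
          ← encard_coe_eq_coe_finsetCard]
        refine encard_le_encard fun k hk => ?_
        exact ⟨mem_univ k, (Finset.mem_filter.1 hk).2.symm⟩
      exact_mod_cast h1
    · rw [Multiset.count_eq_zero.2]
      · exact Nat.zero_le _
      · intro hm
        obtain ⟨k, hk, rfl⟩ := Multiset.mem_map.1 hm
        exact hz (hμN k ((hmemT k).1 hk))
  set e : ℤ ↪ ℤ := ⟨n, hn⟩ with he
  have hTA : T.map e ⊆ A := fun m hm => by
    obtain ⟨k, hk, rfl⟩ := Finset.mem_map.1 hm
    exact (hmemA _).2 ((hmemT k).1 hk)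
  have hAcard : A.card = 2 * N + 1 := by
    rw [hA, Int.card_Icc]
    omega
  -- The disc holds as many zeros as the block has indices, so the zeros left over fit the unused
  -- indices in any order.
  obtain ⟨g, hg⟩ := exists_map_eq_multiset (A \ T.map e) (Z - T.val.map μ) (by
    rw [Multiset.card_sub hle, hZcard, Multiset.card_map, Finset.card_val,
      Finset.card_sdiff_of_subset hTA, hAcard, Finset.card_map])
  set p : ℤ → ℂ := Function.extend n μ g with hp
  have hpn : ∀ k, p (n k) = μ k := fun k => hn.extend_apply _ _ _
  have hpA : A.val.map p = Z := by
    have hAe : A.val = (A \ T.map e).val + (T.map e).val := by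
      rw [← Finset.disjUnion_val _ _ Finset.sdiff_disjoint, Finset.disjUnion_eq_union,
        Finset.sdiff_union_of_subset hTA]
    have h1 : (A \ T.map e).val.map p = (A \ T.map e).val.map g := by
      refine Multiset.map_congr rfl fun m hm => ?_
      refine Function.extend_apply' _ _ _ ?_
      rintro ⟨k, rfl⟩
      have hm' := Finset.mem_sdiff.1 (show n k ∈ A \ T.map e from hm)
      exact hm'.2 (Finset.mem_map.2 ⟨k, (hmemT k).2 ((hmemA _).1 hm'.1), rfl⟩)
    have h2 : (T.map e).val.map p = T.val.map μ := by
      rw [Finset.map_val, Multiset.map_map]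
      exact Multiset.map_congr rfl fun k _ => hpn k
    rw [hAe, Multiset.map_add, h1, h2, hg, tsub_add_cancel_of_le hle]
  have hpball : ∀ m ∈ A, p m ∈ Metric.ball (0 : ℂ) (N + 1 / 2 : ℝ) := fun m hm =>
    hZ.mem_ball _ (hpA ▸ Multiset.mem_map_of_mem p hm)
  set lam : ℤ → ℂ := fun m => if m ∈ A then p m else ζ m with hlam
  have hlam1 : ∀ m ∈ A, lam m = p m := fun m hm => if_pos hm
  have hlam2 : ∀ m ∉ A, lam m = ζ m := fun m hm => if_neg hm
  have hnA : ∀ m : ℤ, m ∉ A → (N : ℤ) < |m| := fun m hm => not_le.1 fun h => hm ((hmemA m).2 h)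
  refine ⟨lam, fun z => ?_, ?_, fun k => ?_⟩
  · by_cases hz : z ∈ Metric.ball (0 : ℂ) (N + 1 / 2 : ℝ)
    · have hset : {m | lam m = z} = ((A.filter fun m => z = p m : Finset ℤ) : Set ℤ) := by
        ext m
        rw [mem_ofPred_eq, Finset.mem_coe, Finset.mem_filter]
        by_cases hm : m ∈ A
        · rw [hlam1 m hm]
          exact ⟨fun h => ⟨hm, h.symm⟩, fun h => h.2.symm⟩
        · rw [hlam2 m hm]
          refine ⟨fun h => absurd (h ▸ hz) (hζball m (hnA m hm)), fun h => absurd h.1 hm⟩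
      rw [hset, encard_coe_eq_coe_finsetCard, ← hZ.count_eq z hz, ← hpA, Multiset.count_map,
        ← Finset.filter_val, Finset.card_val]
    · by_cases hz0 : h z = 0
      · obtain ⟨m, hm, hzm⟩ := (hloc z hz0).resolve_left hz
        have hzζ := hζu m hm z hzm hz0
        have hset : {m' | lam m' = z} = {m} := by
          ext m'
          rw [mem_ofPred_eq, mem_singleton_iff]
          by_cases hm' : m' ∈ A
          · rw [hlam1 m' hm']
            refine ⟨fun h => absurd (h ▸ hpball m' hm') hz, ?_⟩
            rintro rfl
            have := (hmemA m').1 hm'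
            omega
          · rw [hlam2 m' hm']
            constructor
            · intro hζz
              by_contra hne
              have h1 := hζb m' (hnA m' hm')
              rw [hζz, Metric.mem_ball, dist_eq_norm] at h1
              rw [Metric.mem_ball, dist_eq_norm] at hzm
              have h2 := one_le_norm_intCast_sub hne
              have h3 := norm_sub_le_norm_sub_add_norm_sub (m' : ℂ) z m
              rw [norm_sub_rev (m' : ℂ) z] at h3
              linarith
            · rintro rfl
              exact hzζ.symm
        rw [hset, encard_singleton, hzζ, hζo m hm]
      · have hset : {m' | lam m' = z} = ∅ := by
          refine eq_empty_of_forall_notMem fun m hm => ?_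
          rw [mem_ofPred_eq] at hm
          by_cases hmA : m ∈ A
          · rw [hlam1 m hmA] at hm
            exact hz (hm ▸ hpball m hmA)
          · rw [hlam2 m hmA] at hm
            exact hz0 (hm ▸ hζ0 m (hnA m hmA))
        rw [hset, encard_empty, (hd.analyticAt z).analyticOrderAt_eq_zero.2 hz0]
  · rw [memℓp_two_iff]
    refine Summable.of_norm_bounded_eventually (memℓp_two_iff.1 (memℓp_expTransform_int ha ha' hf))
      ?_
    have hfin : {m : ℤ | m ∈ A}.Finite := A.finite_toSet
    filter_upwards [hfin.compl_mem_cofinite] with m hm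
    have hm' : m ∉ A := hm
    rw [Real.norm_of_nonneg (by positivity), hlam2 m hm']
    exact pow_le_pow_left₀ (norm_nonneg _) (hζn m (hnA m hm')) 2
  · by_cases hk : n k ∈ A
    · rw [hlam1 _ hk, hpn]
    · rw [hlam2 _ hk]
      -- Outside the block the node lies within `1/8` of `n k`, where `ζ (n k)` is the only zero.
      refine (hζu _ (hnA _ hk) (μ k) ?_ (hV.apply_eq_zero (mem_univ k))).symm
      rw [Metric.mem_ball, dist_eq_norm, hμ]
      simpa using hκN k (hnA _ hk)

/-- Inverse problem for the function `sin (π z) + F(z)`. -/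
theorem exists_expTransform_numbering {a : ℝ} (ha : 0 < a) (ha' : a < Real.pi) {n : ℤ → ℤ}
    (hn : Function.Injective n) (hR : IsRieszBasis (expSystem a n)) {κ : ℤ → ℂ}
    (hκ : Memℓp κ 2) : ∃ f, MemLp f 2 (symMeasure a) ∧ ∃ lam : ℤ → ℂ,
      (∀ z, {m | lam m = z}.encard = analyticOrderAt (sinPi + expTransform a f) z) ∧
      Memℓp (fun m => lam m - m) 2 ∧ ∀ k, lam (n k) = n k + κ k := by
  obtain ⟨_, ⟨f, hf, rfl⟩, hV⟩ := (isInterpolating_of_isRieszBasis ha' hn hR hκ).exists_eq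
  exact ⟨f, hf, exists_numbering ha ha' hf hn hκ hV⟩

/-! ### The delay system in diagonal form -/

theorem AbsolutelyContinuousOnInterval.of_dist_le {X Y : Type*} [PseudoMetricSpace X]
    [PseudoMetricSpace Y] {f : ℝ → X} {g : ℝ → Y} {c d : ℝ}
    (hg : AbsolutelyContinuousOnInterval g c d) (h : ∀ x y, dist (f x) (f y) ≤ dist (g x) (g y)) :
    AbsolutelyContinuousOnInterval f c d :=
  squeeze_zero (fun _ => Finset.sum_nonneg fun _ _ => dist_nonneg)
    (fun _ => Finset.sum_le_sum fun _ _ => h _ _) hg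

theorem ae_uIcc_iff_ae_restrict_Ioo {P : ℝ → Prop} {d : ℝ} (hd : 0 ≤ d) :
    (∀ᵐ x, x ∈ uIcc 0 d → P x) ↔ ∀ᵐ x ∂volume.restrict (Ioo 0 d), P x := by
  rw [uIcc_of_le hd, ← ae_restrict_iff' measurableSet_Icc, restrict_Ioo_eq_restrict_Icc]

/-- Variation of constants: the solutions of `U' = c U + ρ`. -/
theorem eq_variation_of_constants {c : ℂ} {d : ℝ} (hd : 0 ≤ d) {U ρ : ℝ → ℂ}
    (hU : AbsolutelyContinuousOnInterval U 0 d) (hρ : IntervalIntegrable ρ volume 0 d)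
    (h : ∀ᵐ x ∂volume.restrict (Ioo 0 d), HasDerivAt U (c * U x + ρ x) x) {x : ℝ}
    (hx : x ∈ Icc 0 d) :
    U x = Complex.exp (c * x) * (U 0 + ∫ t in (0 : ℝ)..x, Complex.exp (-c * t) * ρ t) := by
  have key := integral_eq_sub_of_absolutelyContinuous
    ((absolutelyContinuous_of_contDiff (contDiff_cexp_mul (-c)) 0 d).smul hU)
    (f' := fun t => Complex.exp (-c * t) * ρ t)
    (hρ.continuousOn_mul (Continuous.continuousOn (by fun_prop)))
    ((ae_uIcc_iff_ae_restrict_Ioo hd).2 (h.mono fun t ht => by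
      refine ((hasDerivAt_cexp_mul (-c) t).mul ht).congr_deriv ?_
      ring)) (by rwa [uIcc_of_le hd])
  rw [key]
  have e : Complex.exp (c * x) * Complex.exp (-c * x) = 1 := by
    rw [← Complex.exp_add]; simp
  simp only [Pi.smul_apply', smul_eq_mul, Complex.ofReal_zero, mul_zero, Complex.exp_zero, one_mul]
  linear_combination -U x * e

theorem variation_of_constants (c u : ℂ) {d : ℝ} (hd : 0 ≤ d) {ρ : ℝ → ℂ}
    (hρ : IntervalIntegrable ρ volume 0 d) :
    AbsolutelyContinuousOnInterval (fun x : ℝ => Complex.exp (c * x) *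
      (u + ∫ t in (0 : ℝ)..x, Complex.exp (-c * t) * ρ t)) 0 d ∧
    ∀ᵐ x : ℝ ∂volume.restrict (Ioo 0 d), HasDerivAt (fun x : ℝ => Complex.exp (c * x) *
      (u + ∫ t in (0 : ℝ)..x, Complex.exp (-c * t) * ρ t))
      (c * (Complex.exp (c * x) * (u + ∫ t in (0 : ℝ)..x, Complex.exp (-c * t) * ρ t)) + ρ x) x := by
  have hi : IntervalIntegrable (fun t : ℝ => Complex.exp (-c * t) * ρ t) volume 0 d :=
    hρ.continuousOn_mul (Continuous.continuousOn (by fun_prop))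
  constructor
  · exact (absolutelyContinuous_of_contDiff (contDiff_cexp_mul c) 0 d).smul
      ((absolutelyContinuous_of_contDiff contDiff_const 0 d).add
        (absolutelyContinuous_primitive hi left_mem_uIcc))
  · refine (ae_uIcc_iff_ae_restrict_Ioo hd).1 ?_
    filter_upwards [hi.ae_hasDerivAt_integral] with x hx hxm
    refine ((hasDerivAt_cexp_mul c x).mul ((hx hxm 0 left_mem_uIcc).const_add u)).congr_deriv ?_
    have e : Complex.exp (c * x) * Complex.exp (-c * x) = 1 := by
      rw [← Complex.exp_add]; simp
    linear_combination ρ x * e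

/-- The potential with the diagonalised entries `r = p - i q` and `s = p + i q`. -/
def potential (r s : ℝ → ℂ) (x : ℝ) : Matrix (Fin 2) (Fin 2) ℂ :=
  !![Complex.I * (r x - s x) / 2, (r x + s x) / 2;
    (r x + s x) / 2, -(Complex.I * (r x - s x) / 2)]

/-- The delay system in the variables `U = y₁ + i y₂`, `V = y₁ - i y₂`. -/
structure IsDiagSolution (a : ℝ) (r s : ℝ → ℂ) (z : ℂ) (U V : ℝ → ℂ) : Prop where
  ac_fst : AbsolutelyContinuousOnInterval U 0 Real.pi
  ac_snd : AbsolutelyContinuousOnInterval V 0 Real.pi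
  deriv_fst : ∀ᵐ x ∂volume.restrict (Ioo 0 Real.pi),
    HasDerivAt U (Complex.I * z * U x + r x * V (x - a)) x
  deriv_snd : ∀ᵐ x ∂volume.restrict (Ioo 0 Real.pi),
    HasDerivAt V (-(Complex.I * z) * V x + s x * U (x - a)) x

theorem absolutelyContinuous_vec {f g : ℝ → ℂ} {c d : ℝ}
    (hf : AbsolutelyContinuousOnInterval f c d) (hg : AbsolutelyContinuousOnInterval g c d) :
    AbsolutelyContinuousOnInterval (fun x => ![f x, g x]) c d := by
  have hc : ∀ v : Fin 2 → ℂ, AbsolutelyContinuousOnInterval (fun _ : ℝ => v) c d := fun v =>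
    (contDiff_const (n := 1) (𝕜 := ℝ)).contDiffOn.absolutelyContinuousOnInterval
  have h := (hf.smul (hc ![1, 0])).add (hg.smul (hc ![0, 1]))
  refine AbsolutelyContinuousOnInterval.of_dist_le h fun x y => le_of_eq ?_
  congr 1 <;> · ext i; fin_cases i <;> simp

section DelaySystem

variable {a : ℝ} {r s : ℝ → ℂ} {z : ℂ}

theorem IsDiagSolution.isSolution {U V : ℝ → ℂ} (h : IsDiagSolution a r s z U V) :
    IsSolution a (potential r s) z
      fun x => ![(U x + V x) / 2, (U x - V x) / (2 * Complex.I)] := by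
  have h1 : AbsolutelyContinuousOnInterval (fun x => (U x + V x) / 2) 0 Real.pi := by
    have := (h.ac_fst.add h.ac_snd).const_smul (1 / 2 : ℂ)
    refine AbsolutelyContinuousOnInterval.of_dist_le this fun x y => le_of_eq ?_
    congr 1 <;> · simp only [Pi.add_apply, smul_eq_mul]; ring
  have h2 : AbsolutelyContinuousOnInterval (fun x => (U x - V x) / (2 * Complex.I)) 0 Real.pi := by
    have := (h.ac_fst.sub h.ac_snd).const_smul (1 / (2 * Complex.I) : ℂ)
    refine AbsolutelyContinuousOnInterval.of_dist_le this fun x y => le_of_eq ?_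
    congr 1 <;> · simp only [Pi.sub_apply, smul_eq_mul]; ring
  refine ⟨absolutelyContinuous_vec h1 h2, ?_⟩
  filter_upwards [h.deriv_fst, h.deriv_snd] with x hU hV
  have hd : HasDerivAt (fun x => ![(U x + V x) / 2, (U x - V x) / (2 * Complex.I)])
      ![(Complex.I * z * U x + r x * V (x - a) + (-(Complex.I * z) * V x + s x * U (x - a))) / 2,
        (Complex.I * z * U x + r x * V (x - a) - (-(Complex.I * z) * V x + s x * U (x - a))) /
          (2 * Complex.I)] x := by
    rw [hasDerivAt_pi]
    intro i
    fin_cases i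
    · simpa using (hU.add hV).div_const 2
    · simpa using (hU.sub hV).div_const (2 * Complex.I)
  refine ⟨hd.differentiableAt, ?_⟩
  rw [hd.deriv]
  have hI := Complex.I_sq
  have hI0 := Complex.I_ne_zero
  ext i
  fin_cases i
  · simp [B, potential]
    field_simp
    ring_nf
    simp only [hI]
    ring
  · simp [B, potential]
    field_simp
    ring_nf
    simp only [hI]
    ring

theorem IsSolution.isDiagSolution {y : ℝ → Fin 2 → ℂ} (h : IsSolution a (potential r s) z y) :
    IsDiagSolution a r s z (fun x => y x 0 + Complex.I * y x 1)
      (fun x => y x 0 - Complex.I * y x 1) := by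
  have hc : ∀ i, AbsolutelyContinuousOnInterval (fun x => y x i) 0 Real.pi := fun i =>
    AbsolutelyContinuousOnInterval.of_dist_le h.1 fun x x' => dist_le_pi_dist (y x) (y x') i
  have hd : ∀ᵐ x ∂volume.restrict (Ioo 0 Real.pi),
      HasDerivAt (fun x => y x 0 + Complex.I * y x 1)
        (Complex.I * z * (y x 0 + Complex.I * y x 1) +
          r x * (y (x - a) 0 - Complex.I * y (x - a) 1)) x ∧
      HasDerivAt (fun x => y x 0 - Complex.I * y x 1)
        (-(Complex.I * z) * (y x 0 - Complex.I * y x 1) +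
          s x * (y (x - a) 0 + Complex.I * y (x - a) 1)) x := by
    filter_upwards [h.2] with x hx
    obtain ⟨hx1, hx2⟩ := hx
    have hy := hasDerivAt_pi.1 hx1.hasDerivAt
    have e0 := congrFun hx2 0
    have e1 := congrFun hx2 1
    simp [B, potential, dotProduct, Fin.sum_univ_two] at e0 e1
    have hI := Complex.I_sq
    constructor
    · refine ((hy 0).add ((hy 1).const_mul Complex.I)).congr_deriv ?_
      linear_combination (-1 : ℂ) * e1 + Complex.I * e0 + (-z * y x 1 -
        (r x - s x) / 2 * y (x - a) 0) * hI
    · refine ((hy 0).sub ((hy 1).const_mul Complex.I)).congr_deriv ?_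
      linear_combination (-1 : ℂ) * e1 - Complex.I * e0 + (-z * y x 1 +
        (r x - s x) / 2 * y (x - a) 0) * hI
  exact ⟨(hc 0).add ((hc 1).const_smul Complex.I), (hc 0).sub ((hc 1).const_smul Complex.I),
    hd.mono fun _ h => h.1, hd.mono fun _ h => h.2⟩

/-! ### The fundamental solution and the characteristic functions -/

/-- The first component, `U`, of the solution of the diagonalised system with initial values
`u`, `v`; the second component is `diagComponent a s (-z) v u`. -/
def diagComponent (a : ℝ) (r : ℝ → ℂ) (z u v : ℂ) (x : ℝ) : ℂ :=
  Complex.exp (Complex.I * z * x) * (u + ∫ t in (0 : ℝ)..x, Complex.exp (-(Complex.I * z) * t) *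
    (r t * (Complex.exp (-(Complex.I * z) * ((t - a : ℝ) : ℂ)) * v)))

theorem diagComponent_zero (a : ℝ) (r : ℝ → ℂ) (z u v : ℂ) : diagComponent a r z u v 0 = u := by
  simp [diagComponent]

theorem diagComponent_of_le (hr : ∀ t ≤ a, r t = 0) {x : ℝ} (hx0 : 0 ≤ x) (hx : x ≤ a) (u v : ℂ) :
    diagComponent a r z u v x = Complex.exp (Complex.I * z * x) * u := by
  rw [diagComponent, intervalIntegral.integral_congr (g := fun _ => 0), intervalIntegral.integral_zero,
    add_zero]
  intro t ht
  rw [uIcc_of_le hx0] at ht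
  simp [hr t (ht.2.trans hx)]

theorem intervalIntegrable_mul_cexp (hri : IntervalIntegrable r volume 0 Real.pi) (c v : ℂ) :
    IntervalIntegrable (fun t => r t * (Complex.exp (c * ((t - a : ℝ) : ℂ)) * v))
      volume 0 Real.pi :=
  hri.mul_continuousOn (Continuous.continuousOn (by fun_prop))

/-- For `a < x < π` one has `x - a < π - a ≤ a`, so the delayed component is still the free
exponential that `diagComponent` inserts; for `x ≤ a` the coefficient vanishes and the delayed value
is irrelevant. -/
theorem isDiagSolution_diagComponent (ha : Real.pi / 2 ≤ a)
    (hri : IntervalIntegrable r volume 0 Real.pi) (hsi : IntervalIntegrable s volume 0 Real.pi)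
    (hr : ∀ t ≤ a, r t = 0) (hs : ∀ t ≤ a, s t = 0) (z u v : ℂ) :
    IsDiagSolution a r s z (diagComponent a r z u v) (diagComponent a s (-z) v u) := by
  have hU := variation_of_constants (Complex.I * z) u Real.pi_pos.le
    (intervalIntegrable_mul_cexp (a := a) hri (-(Complex.I * z)) v)
  have hV := variation_of_constants (Complex.I * -z) v Real.pi_pos.le
    (intervalIntegrable_mul_cexp (a := a) hsi (-(Complex.I * -z)) u)
  refine ⟨hU.1, hV.1, ?_, ?_⟩
  · filter_upwards [hU.2, ae_restrict_mem measurableSet_Ioo] with x hx hxm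
    refine hx.congr_deriv ?_
    congr 1
    rcases le_or_gt x a with h | h
    · simp [hr x h]
    · rw [diagComponent_of_le hs (by linarith) (by linarith [hxm.2]), mul_neg]
  · filter_upwards [hV.2, ae_restrict_mem measurableSet_Ioo] with x hx hxm
    refine hx.congr_deriv ?_
    congr 1
    · rw [diagComponent, mul_neg]
    · rcases le_or_gt x a with h | h
      · simp [hs x h]
      · rw [diagComponent_of_le hr (by linarith) (by linarith [hxm.2]), mul_neg, neg_neg]

theorem IsDiagSolution.eq_of_le {U V : ℝ → ℂ} (h : IsDiagSolution a r s z U V) (ha : 0 ≤ a)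
    (ha' : a ≤ Real.pi) (hr : ∀ t ≤ a, r t = 0) {x : ℝ} (hx : x ∈ Icc 0 a) :
    U x = Complex.exp (Complex.I * z * x) * U 0 := by
  have := eq_variation_of_constants (c := Complex.I * z) (ρ := fun _ => 0) ha
    (h.ac_fst.mono (uIcc_subset_uIcc_left (by rw [uIcc_of_le Real.pi_pos.le]; exact ⟨ha, ha'⟩)))
    (by simp) (by
      have h1 := ae_restrict_of_ae_restrict_of_subset (Ioo_subset_Ioo_right ha') h.deriv_fst
      filter_upwards [h1, ae_restrict_mem measurableSet_Ioo] with t ht htm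
      rw [hr t htm.2.le, zero_mul] at ht
      exact ht) hx
  simpa using this

theorem IsDiagSolution.symm {U V : ℝ → ℂ} (h : IsDiagSolution a r s z U V) :
    IsDiagSolution a s r (-z) V U :=
  ⟨h.ac_snd, h.ac_fst, by simpa using h.deriv_snd, by simpa using h.deriv_fst⟩

/-- Uniqueness by the same two stages: the delayed component is forced on `[0, a]`, and then enters
as a known inhomogeneity. -/
theorem IsDiagSolution.eq_diagComponent {U V : ℝ → ℂ} (h : IsDiagSolution a r s z U V)
    (ha : Real.pi / 2 ≤ a) (ha' : a < Real.pi) (hri : IntervalIntegrable r volume 0 Real.pi)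
    (hr : ∀ t ≤ a, r t = 0) (hs : ∀ t ≤ a, s t = 0) {x : ℝ} (hx : x ∈ Icc 0 Real.pi) :
    U x = diagComponent a r z (U 0) (V 0) x := by
  refine eq_variation_of_constants Real.pi_pos.le h.ac_fst
    (intervalIntegrable_mul_cexp (a := a) hri (-(Complex.I * z)) (V 0)) ?_ hx
  filter_upwards [h.deriv_fst, ae_restrict_mem measurableSet_Ioo] with x hx hxm
  refine hx.congr_deriv ?_
  congr 1
  rcases le_or_gt x a with h' | h'
  · simp [hr x h']
  · rw [h.symm.eq_of_le (by linarith [Real.pi_pos]) ha'.le hs ⟨by linarith, by linarith [hxm.2]⟩,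
      mul_neg]

theorem diagComponent_mul (c u v : ℂ) (x : ℝ) :
    diagComponent a r z (c * u) (c * v) x = c * diagComponent a r z u v x := by
  rw [diagComponent, diagComponent, mul_left_comm c, mul_add c, ← intervalIntegral.integral_const_mul]
  congr 3
  funext t
  ring

/-- The solution of the delay system with `U(0) = u`, `V(0) = v`. -/
def solution (a : ℝ) (r s : ℝ → ℂ) (z u v : ℂ) (x : ℝ) : Fin 2 → ℂ :=
  ![(diagComponent a r z u v x + diagComponent a s (-z) v u x) / 2,
    (diagComponent a r z u v x - diagComponent a s (-z) v u x) / (2 * Complex.I)]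

/-- The fundamental matrix-solution. -/
def fundamental (a : ℝ) (r s : ℝ → ℂ) (z : ℂ) (x : ℝ) : Matrix (Fin 2) (Fin 2) ℂ :=
  fun i c => ![solution a r s z 1 1 x, solution a r s z Complex.I (-Complex.I) x] c i

/-- The initial vectors `(1, 0)` and `(0, 1)` correspond to `(U, V)(0) = (1, 1)` and `(i, -i)`. -/
theorem isFundamental_fundamental (ha : Real.pi / 2 ≤ a)
    (hri : IntervalIntegrable r volume 0 Real.pi) (hsi : IntervalIntegrable s volume 0 Real.pi)
    (hr : ∀ t ≤ a, r t = 0) (hs : ∀ t ≤ a, s t = 0) (z : ℂ) :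
    IsFundamental a (potential r s) z (fundamental a r s z) := by
  refine ⟨fun c => ?_, ?_⟩
  · fin_cases c
    · exact (isDiagSolution_diagComponent ha hri hsi hr hs z 1 1).isSolution
    · exact (isDiagSolution_diagComponent ha hri hsi hr hs z Complex.I (-Complex.I)).isSolution
  · ext i c
    fin_cases i <;> fin_cases c <;> simp [fundamental, solution, diagComponent_zero]
    field_simp
    norm_num

/-- By uniqueness, a solution with `y₁(0) = 0` is `y₂(0)` times the one starting at `(0, 1)`, and it
is nontrivial only if `y₂(0) ≠ 0`. -/
theorem isEigenvalue_iff (ha : Real.pi / 2 ≤ a) (ha' : a < Real.pi)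
    (hri : IntervalIntegrable r volume 0 Real.pi) (hsi : IntervalIntegrable s volume 0 Real.pi)
    (hr : ∀ t ≤ a, r t = 0) (hs : ∀ t ≤ a, s t = 0) (j : Fin 2) (z : ℂ) :
    IsEigenvalue a (potential r s) 0 j z ↔
      solution a r s z Complex.I (-Complex.I) Real.pi j = 0 := by
  have h0 : solution a r s z Complex.I (-Complex.I) 0 = ![0, 1] := by
    ext i
    fin_cases i
    · simp [solution, diagComponent_zero]
    · simp only [solution, diagComponent_zero]
      simp
      field_simp
      norm_num
  constructor
  · rintro ⟨y, hy, ⟨x, hx, hyx⟩, hy0, hyj⟩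
    have hd := hy.isDiagSolution
    have key : ∀ x ∈ Icc 0 Real.pi,
        y x = y 0 1 • solution a r s z Complex.I (-Complex.I) x := by
      intro x hx
      have h1 := hd.eq_diagComponent ha ha' hri hr hs hx
      have h2 := hd.symm.eq_diagComponent ha ha' hsi hs hr hx
      rw [hy0, zero_add, zero_sub, mul_comm Complex.I (y 0 1), ← mul_neg, diagComponent_mul]
        at h1 h2
      ext i
      fin_cases i
      · simp only [solution, Pi.smul_apply, smul_eq_mul]
        simp
        linear_combination h1 / 2 + h2 / 2
      · simp only [solution, Pi.smul_apply, smul_eq_mul]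
        simp
        field_simp
        linear_combination h1 - h2
    have hc : y 0 1 ≠ 0 := fun hc => hyx (by rw [key x hx, hc, zero_smul])
    rw [key Real.pi (right_mem_Icc.2 Real.pi_pos.le), Pi.smul_apply, smul_eq_mul] at hyj
    exact (mul_eq_zero.1 hyj).resolve_left hc
  · intro h
    refine ⟨solution a r s z Complex.I (-Complex.I),
      (isDiagSolution_diagComponent ha hri hsi hr hs z _ _).isSolution,
      ⟨0, left_mem_Icc.2 Real.pi_pos.le, fun hz => ?_⟩, by rw [h0]; rfl, h⟩
    have := congrFun (h0.symm.trans hz) 1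
    simp at this

theorem memLp_comp_affine {g : ℝ → ℂ} (hg : MemLp g 2 volume) {c : ℝ} (hc : c ≠ 0) (d : ℝ) :
    MemLp (fun t => g (c * t + d)) 2 volume := by
  have h1 : MemLp (fun t => g (t + d)) 2 volume :=
    hg.comp_measurePreserving (measurePreserving_add_right volume d)
  have h2 : MemLp (fun t => g (t + d)) 2 (Measure.map (c * ·) volume) := by
    rw [Real.map_volume_mul_left hc]
    exact h1.smul_measure ENNReal.ofReal_ne_top
  exact h2.comp_of_map (measurable_const_mul c).aemeasurable

/-- The three exponentials combine to `exp (i z (π + a - 2t))`; the substitution `σ = π + a - 2t`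
maps `(a, π)` onto `(a - π, π - a)`, and the factor `2` cancels its Jacobian. -/
theorem diagComponent_pi (ha : 0 ≤ a) (ha' : a < Real.pi) (R : ℝ → ℂ) (z u v : ℂ) :
    diagComponent a (fun t => 2 * (Ioo (a - Real.pi) (Real.pi - a)).indicator R
      (-2 * t + (Real.pi + a))) z u v Real.pi =
      Complex.exp (Complex.I * z * Real.pi) * u + expTransform a R z * v := by
  set I := Ioo (a - Real.pi) (Real.pi - a) with hI
  have h1 : ∀ t : ℝ, Complex.exp (Complex.I * z * Real.pi) *
      (Complex.exp (-(Complex.I * z) * t) * (2 * I.indicator R (-2 * t + (Real.pi + a)) *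
        (Complex.exp (-(Complex.I * z) * ((t - a : ℝ) : ℂ)) * v))) =
      2 * v * (fun σ : ℝ => I.indicator (fun σ => R σ * Complex.exp (Complex.I * z * σ)) σ)
        (-2 * t + (Real.pi + a)) := by
    intro t
    by_cases ht : -2 * t + (Real.pi + a) ∈ I
    · simp only [indicator_of_mem ht]
      have : Complex.exp (Complex.I * z * ((-2 * t + (Real.pi + a) : ℝ) : ℂ)) =
          Complex.exp (Complex.I * z * Real.pi) * Complex.exp (-(Complex.I * z) * t) *
            Complex.exp (-(Complex.I * z) * ((t - a : ℝ) : ℂ)) := by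
        rw [← Complex.exp_add, ← Complex.exp_add]
        congr 1
        push_cast
        ring
      rw [this]
      ring
    · simp only [indicator_of_notMem ht]
      ring
  rw [diagComponent, mul_add, ← intervalIntegral.integral_const_mul]
  congr 1
  simp only [h1]
  rw [intervalIntegral.integral_const_mul, intervalIntegral.integral_comp_mul_add
    (fun σ : ℝ => I.indicator (fun σ => R σ * Complex.exp (Complex.I * z * σ)) σ)
    (by norm_num : (-2 : ℝ) ≠ 0)]
  have e1 : -2 * Real.pi + (Real.pi + a) = a - Real.pi := by ring
  have e2 : -2 * (0 : ℝ) + (Real.pi + a) = Real.pi + a := by ring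
  rw [e1, e2, intervalIntegral.integral_symm, intervalIntegral.integral_of_le (by linarith),
    setIntegral_indicator measurableSet_Ioo, inter_eq_right.2 (show I ⊆ Ioc (a - Real.pi) (Real.pi + a) from fun x hx =>
      ⟨hx.1, by linarith [hx.2]⟩), expTransform]
  rw [Complex.real_smul]
  push_cast
  ring

/-- Needed because the second component is computed at the parameter `-z`. -/
theorem expTransform_comp_neg (ha' : a < Real.pi) (S : ℝ → ℂ) (z : ℂ) :
    expTransform a (fun x => S (-x)) (-z) = expTransform a S z := by
  have h := intervalIntegral.integral_comp_neg (a := a - Real.pi) (b := Real.pi - a)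
    fun x : ℝ => S x * Complex.exp (Complex.I * z * x)
  rw [neg_sub, neg_sub] at h
  rw [expTransform_eq_intervalIntegral ha', expTransform_eq_intervalIntegral ha', ← h]
  refine intervalIntegral.integral_congr fun x _ => ?_
  simp

/-- The characteristic function of the problem with the index `j` and the density `w`. -/
def charFn (a : ℝ) (j : Fin 2) (w : ℝ → ℂ) (z : ℂ) : ℂ :=
  ![-Complex.sin (Real.pi * z), Complex.cos (Real.pi * z)] j + expTransform a w z

theorem differentiable_charFn (j : Fin 2) {w : ℝ → ℂ} (hw : Integrable w (symMeasure a)) :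
    Differentiable ℂ (charFn a j w) := by
  have hs := differentiable_expTransform hw
  unfold charFn
  fin_cases j
  · simp only [Fin.zero_eta, Matrix.cons_val_zero]
    fun_prop
  · simp only [Fin.mk_one, Matrix.cons_val_one, Matrix.cons_val_fin_one]
    fun_prop

/-- Any two densities are realised by the characteristic functions of a common potential. -/
theorem exists_potential (ha : Real.pi / 2 ≤ a) (ha' : a < Real.pi) {w : Fin 2 → ℝ → ℂ}
    (hw : ∀ j, MemLp (w j) 2 (symMeasure a)) : ∃ Q : ℝ → Matrix (Fin 2) (Fin 2) ℂ,
      IsAdmissible a Q ∧ ∀ j, IsCharFunction a Q 0 j (charFn a j (w j)) ∧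
        ∀ z, IsEigenvalue a Q 0 j z ↔ charFn a j (w j) z = 0 := by
  have ha0 : 0 ≤ a := by linarith [Real.pi_pos]
  set I := Ioo (a - Real.pi) (Real.pi - a) with hI
  -- With initial values `(i, -i)` the integral parts of `y₁(π)` and `y₂(π)` have densities `i(S -
  -- R)/2` and `-(R + S)/2`. Equating these to `w 0` and `w 1` gives `R` and `S`.
  set R : ℝ → ℂ := fun x => -w 1 x + Complex.I * w 0 x with hR
  set S : ℝ → ℂ := fun x => -w 1 x + -Complex.I * w 0 x with hS
  set r : ℝ → ℂ := fun t => 2 * I.indicator R (-2 * t + (Real.pi + a)) with hrdef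
  set s : ℝ → ℂ := fun t => 2 * I.indicator (fun x => S (-x)) (-2 * t + (Real.pi + a)) with hsdef
  have hRL : MemLp R 2 (symMeasure a) := (hw 1).neg.add ((hw 0).const_mul _)
  have hSL : MemLp S 2 (symMeasure a) := (hw 1).neg.add ((hw 0).const_mul _)
  have hSL' : MemLp (I.indicator fun x => S (-x)) 2 volume := by
    have h := memLp_comp_affine ((memLp_indicator_iff_restrict measurableSet_Ioo).2 hSL)
      (by norm_num : (-1 : ℝ) ≠ 0) 0
    convert h using 2 with x
    have : -1 * x + 0 = -x := by ring
    rw [this]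
    by_cases hx : x ∈ I
    · have hx' : -x ∈ I := ⟨by linarith [hx.2], by linarith [hx.1]⟩
      rw [indicator_of_mem hx, indicator_of_mem hx']
    · have hx' : -x ∉ I := fun h => hx ⟨by linarith [h.2], by linarith [h.1]⟩
      rw [indicator_of_notMem hx, indicator_of_notMem hx']
  have hr2 : MemLp r 2 volume := (memLp_comp_affine
    ((memLp_indicator_iff_restrict measurableSet_Ioo).2 hRL) (by norm_num) _).const_mul 2
  have hs2 : MemLp s 2 volume := (memLp_comp_affine hSL' (by norm_num) _).const_mul 2
  have hout : ∀ t ≤ a, -2 * t + (Real.pi + a) ∉ I := fun t ht h => by linarith [h.2]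
  have hr0 : ∀ t ≤ a, r t = 0 := fun t ht => by
    simp only [hrdef, indicator_of_notMem (hout t ht), mul_zero]
  have hs0 : ∀ t ≤ a, s t = 0 := fun t ht => by
    simp only [hsdef, indicator_of_notMem (hout t ht), mul_zero]
  have hint : ∀ {g : ℝ → ℂ}, MemLp g 2 volume → IntervalIntegrable g volume 0 Real.pi :=
    fun hg => (intervalIntegrable_iff_integrableOn_Ioo_of_le Real.pi_pos.le).2
      ((hg.restrict _).integrable (by norm_num))
  have hri := hint hr2
  have hsi := hint hs2
  have hT : ∀ (c : ℂ) z, expTransform a (fun x => -w 1 x + c * w 0 x) z =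
      -expTransform a (w 1) z + c * expTransform a (w 0) z := fun c z => by
    have h0 := integrable_of_memLp (hw 0)
    have h1 := integrable_of_memLp (hw 1)
    have e1 := congrFun (expTransform_add (h1.const_mul (-1)) (h0.const_mul c)) z
    rw [Pi.add_apply, expTransform_const_mul, expTransform_const_mul] at e1
    rw [← neg_one_mul, ← e1]
    congr 1
    funext x
    simp
  have hU : ∀ z u v, diagComponent a r z u v Real.pi = Complex.exp (Complex.I * z * Real.pi) * u +
      (-expTransform a (w 1) z + Complex.I * expTransform a (w 0) z) * v := fun z u v => by
    rw [diagComponent_pi ha0 ha', hT]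
  have hV : ∀ z u v, diagComponent a s (-z) v u Real.pi =
      Complex.exp (Complex.I * -z * Real.pi) * v +
      (-expTransform a (w 1) z + -Complex.I * expTransform a (w 0) z) * u := fun z u v => by
    rw [diagComponent_pi ha0 ha', expTransform_comp_neg ha', hT]
  have hΔ : ∀ j z, solution a r s z Complex.I (-Complex.I) Real.pi j = charFn a j (w j) z := by
    intro j z
    have e1 : Complex.exp (Complex.I * z * Real.pi) =
        Complex.cos (Real.pi * z) + Complex.sin (Real.pi * z) * Complex.I := by
      rw [← Complex.exp_mul_I]
      congr 1
      ring
    have e2 : Complex.exp (Complex.I * -z * Real.pi) =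
        Complex.cos (Real.pi * z) - Complex.sin (Real.pi * z) * Complex.I := by
      have := Complex.exp_mul_I (-(Real.pi * z))
      rw [Complex.cos_neg, Complex.sin_neg] at this
      rw [sub_eq_add_neg, ← neg_mul, ← this]
      congr 1
      ring
    have hI2 := Complex.I_sq
    have hI0 := Complex.I_ne_zero
    unfold charFn
    fin_cases j
    · simp only [solution, hU, hV, e1, e2, Fin.zero_eta, Matrix.cons_val_zero]
      linear_combination (Complex.sin (Real.pi * z) - expTransform a (w 0) z) * hI2
    · simp only [solution, hU, hV, e1, e2, Fin.mk_one, Matrix.cons_val_one]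
      simp
      field_simp
      ring_nf
  refine ⟨potential r s, ⟨fun i k => ?_, ?_, ?_, ?_⟩, fun j => ⟨⟨differentiable_charFn j
    (integrable_of_memLp (hw j)), fun z => ⟨fundamental a r s z,
      isFundamental_fundamental ha hri hsi hr0 hs0 z, (hΔ j z).symm⟩⟩, fun z => ?_⟩⟩
  · have hp : MemLp (fun x => (r x + s x) / 2) 2 (volume.restrict (Ioo 0 Real.pi)) := by
      have := ((hr2.add hs2).const_mul (1 / 2)).restrict (Ioo 0 Real.pi)
      convert this using 2 with x
      simp only [Pi.add_apply]
      ring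
    have hq : MemLp (fun x => Complex.I * (r x - s x) / 2) 2
        (volume.restrict (Ioo 0 Real.pi)) := by
      have := ((hr2.sub hs2).const_mul (Complex.I / 2)).restrict (Ioo 0 Real.pi)
      convert this using 2 with x
      simp only [Pi.sub_apply]
      ring
    fin_cases i <;> fin_cases k
    · exact hq
    · exact hp
    · exact hp
    · exact hq.neg
  · refine ae_restrict_of_forall_mem measurableSet_Ioo fun x hx => ?_
    ext i k
    fin_cases i <;> fin_cases k <;> simp [potential, hr0 x hx.2.le, hs0 x hx.2.le]
  · exact Eventually.of_forall fun x => by simp [potential]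
  · exact Eventually.of_forall fun x => by simp [potential]
  · rw [isEigenvalue_iff ha ha' hri hsi hr0 hs0, hΔ]

end DelaySystem

/-! ### Shifting the spectral parameter -/

theorem analyticOrderAt_comp_add {h : ℂ → ℂ} (hh : Differentiable ℂ h) {ε : ℂ} (hε : ε ≠ 0)
    (c z : ℂ) : analyticOrderAt (fun w => ε * h (w + c)) z = analyticOrderAt h (z + c) := by
  have h1 := analyticOrderAt_mul (f := fun _ : ℂ => ε) (g := fun w => h (w + c)) (z₀ := z)
    analyticAt_const ((hh.comp (differentiable_id.add_const c)).analyticAt z)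
  have e : ((fun _ => ε) * fun w => h (w + c) : ℂ → ℂ) = fun w => ε * h (w + c) := rfl
  rw [e, (analyticAt_const (v := ε)).analyticOrderAt_eq_zero.2 hε, zero_add] at h1
  rw [h1]
  have hd : HasDerivAt (fun w : ℂ => w + c) 1 z := (hasDerivAt_id z).add_const c
  have h2 := analyticOrderAt_comp_of_deriv_ne_zero (f := h) (g := fun w : ℂ => w + c) (z₀ := z)
    (by fun_prop) (by rw [hd.deriv]; exact one_ne_zero)
  exact h2

/-- The shift by `j/2` reduces both problems to `sin πz + F(z)`. The density is chosen before `Q`,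
so that densities found separately for the two problems can later be realised by one potential. -/
theorem exists_density {a : ℝ} (ha : 0 < a) (ha' : a < Real.pi) (j : Fin 2) {n : ℤ → ℤ}
    (hn : Function.Injective n) (hR : IsRieszBasis (expSystem a n)) {μ : ℤ → ℂ}
    (hμ : HasAsymptotics j n μ) : ∃ w, MemLp w 2 (symMeasure a) ∧
      ∀ Q, IsCharFunction a Q 0 j (charFn a j w) →
        (∀ z, IsEigenvalue a Q 0 j z ↔ charFn a j w z = 0) → IsSubspectrum a Q j n μ := by
  obtain ⟨f, hf, lam, hord, hlam, hlamn⟩ := exists_expTransform_numbering ha ha' hn hR hμ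
  have hfi := integrable_of_memLp hf
  set c : ℂ := (j.val : ℂ) / 2 with hc
  set h := sinPi + expTransform a f with hh
  have hd : Differentiable ℂ h := differentiable_sinPi.add (differentiable_expTransform hfi)
  obtain ⟨w, ε, hw, hε, hΔ⟩ : ∃ (w : ℝ → ℂ) (ε : ℂ), MemLp w 2 (symMeasure a) ∧ ε ≠ 0 ∧
      charFn a j w = fun z => ε * h (z + c) := by
    fin_cases j
    · refine ⟨fun x => -1 * f x, -1, hf.const_mul _, by norm_num, funext fun z => ?_⟩
      simp only [charFn, expTransform_const_mul, hh, hc, Pi.add_apply, sinPi]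
      simp
      ring
    -- Multiplying the density by `exp (i x / 2)` shifts the argument of its transform by `1/2`,
    -- matching `cos πz = sin π(z + 1/2)`.
    · refine ⟨fun x => f x * Complex.exp (Complex.I * (1 / 2 : ℂ) * x), 1, ?_, one_ne_zero,
        funext fun z => ?_⟩
      · have hb := ae_norm_cexp_le a (1 / 2)
        refine hf.of_le_mul (c := Real.exp (|(1 / 2 : ℂ).im| * (Real.pi - a)))
          (hf.1.mul (aestronglyMeasurable_cexp _)) ?_
        filter_upwards [hb] with x hx
        rw [norm_mul, mul_comm]
        exact mul_le_mul_of_nonneg_right hx (norm_nonneg _)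
      · have e1 : sinPi (z + 1 / 2) = Complex.cos (Real.pi * z) := by
          rw [sinPi, ← Complex.sin_add_pi_div_two]
          congr 1
          ring
        have e2 : expTransform a (fun x => f x * Complex.exp (Complex.I * (1 / 2 : ℂ) * x)) z =
            expTransform a f (z + 1 / 2) := by
          refine integral_congr_ae (Eventually.of_forall fun x => ?_)
          simp only
          rw [mul_assoc, ← Complex.exp_add]
          congr 2
          ring
        have e3 : z + c = z + 1 / 2 := by simp [hc]
        simp only [charFn, hh, Pi.add_apply, e2, e3, e1, Fin.mk_one, Matrix.cons_val_one, one_mul]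
        simp
  refine ⟨w, hw, fun Q hQ hQe => ⟨fun m => lam m - c, ⟨fun z => ?_, _, hQ, fun z => ?_⟩, ?_,
    fun k => ?_⟩⟩
  · rw [hQe, hΔ]
    simp only [mul_eq_zero, hε, false_or, mem_range, sub_eq_iff_eq_add]
    rw [← (hd.analyticAt _).analyticOrderAt_ne_zero, ← hord, encard_ne_zero]
    rfl
  · rw [hΔ, analyticOrderAt_comp_add hd hε, ← hord]
    simp only [sub_eq_iff_eq_add]
  · have : (fun m : ℤ => lam m - c - (((id m : ℤ) : ℂ) - (j.val : ℂ) / 2)) =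
        fun m => lam m - m := by
      funext m
      rw [hc, id]
      ring
    rw [HasAsymptotics, this]
    exact hlam
  · simp only [hlamn, hc]
    ring

end DelayDirac

end


/-! ### Realising the densities by a common potential -/

theorem theorem3 (a : ℝ) (ha : Real.pi / 2 ≤ a) (ha' : a < Real.pi) :
    (∀ (j : Fin 2) (n : ℤ → ℤ) (μ : ℤ → ℂ), StrictMono n →
      DelayDirac.IsRieszBasis (DelayDirac.expSystem a n) →
      DelayDirac.HasAsymptotics j n μ →
      ∃ Q : ℝ → Matrix (Fin 2) (Fin 2) ℂ,
        DelayDirac.IsAdmissible a Q ∧ DelayDirac.IsSubspectrum a Q j n μ) ∧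
    (∀ (n : Fin 2 → ℤ → ℤ) (μ : Fin 2 → ℤ → ℂ), (∀ j, StrictMono (n j)) →
      (∀ j, DelayDirac.IsRieszBasis (DelayDirac.expSystem a (n j))) →
      (∀ j, DelayDirac.HasAsymptotics j (n j) (μ j)) →
      ∃ Q : ℝ → Matrix (Fin 2) (Fin 2) ℂ,
        DelayDirac.IsAdmissible a Q ∧ ∀ j, DelayDirac.IsSubspectrum a Q j (n j) (μ j)) := by
  have ha0 : 0 < a := by linarith [Real.pi_pos]
  refine ⟨fun j n μ hn hR hμ => ?_, fun n μ hn hR hμ => ?_⟩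
  · obtain ⟨w, hw, hsub⟩ := DelayDirac.exists_density ha0 ha' j hn.injective hR hμ
    -- The density of the other problem is unconstrained here; repeating `w` is an arbitrary choice.
    obtain ⟨Q, hQ, h⟩ := DelayDirac.exists_potential ha ha' (w := fun _ => w) fun _ => hw
    exact ⟨Q, hQ, hsub Q (h j).1 (h j).2⟩
  · choose w hw hsub using fun j =>
      DelayDirac.exists_density ha0 ha' j (hn j).injective (hR j) (hμ j)
    obtain ⟨Q, hQ, h⟩ := DelayDirac.exists_potential ha ha' hw
    exact ⟨Q, hQ, fun j => hsub j Q (h j).1 (h j).2⟩
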